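/- Let $0<\alpha\le 1$ and let $p$ be a probability mass function on $\mathbb Z$ with $p(0)=0$ that is symmetric ($p(-x)=p(x)$) and aperiodic (its support generates the group $\mathbb Z$), and suppose that $$\sum_{|y|\ge x}p(y)=\frac{L(x)}{x^{\alpha}}\,(1+o(1))\qquad (x\to\infty)$$ for a slowly varying function $L:[0,\infty)\to(0,\infty)$, i.e. $L(cx)/L(x)\to1$ as $x\to\infty$ for every $c>0$. For $x\in\mathbb Z$ let $(X^x_t)_{t\ge0}$ be the rate $1$ continuous-time random walk with jump kernel $p$ started from $X^x_0=x$, write $X_t=X^0_t$, and let $$\tau_x=\inf\{t:\ X^x_t=0\text{ and }X^x_s\ne0\text{ for some }0<s<t\}\qquad(\inf\emptyset=\infty).$$ Let $g_\alpha$ be the density of the symmetric stable law with characteristic function $e^{-\gamma|u|^\alpha}$, where $\gamma=\cos(\pi\alpha/2)\,\Gamma(1-\alpha)$ if $\alpha<1$ and $\gamma=\pi/2$ if $\alpha=1$. Put $$B_t=\frac{g_\alpha(0)}{\mathbb P(X_t=0)},\qquad l(t)=\frac1{g_\alpha(0)}\int_0^t\mathbb P(X_s=0)\,ds=\int_0^t\frac{ds}{B_s},\qquad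 \ell(t)=\frac{B_t\,l(t)}{t},$$ and let the potential kernel be $$a(x)=\lim_{t\to\infty}\int_0^t\big(\mathbb P(X^0_s=0)-\mathbb P(X^x_s=0)\big)\,ds .$$ Then the limit defining $a(x)$ exists in $\mathbb R$ for every $x\in\mathbb Z$, and the following estimates hold. (1) If $\alpha=1$, there exist $\kappa>0$, $C$ and $t_0$ such that for all $t\ge t_0$ and all $x\in\mathbb Z\setminus\{0\}$, $$\Big|\mathbb P(\tau_x>t)-\frac{a(x)}{g_\alpha(0)\,l(t)}\Big|\le C\Big(\frac{a(x)}{l(t)\,\ell(t)}+\frac{|x|}{t^{\kappa}}\Big).$$ (2) If $0<\alpha<1$, then for every $\varepsilon>0$ there exist $C$ and $t_0$ such that for all $t\ge t_0$ and all $x\in\mathbb Z\setminus\{0\}$, $$\Big|\mathbb P(\tau_x>t)-\frac{a(x)}{g_\alpha(0)\,l(t)}\Big|\le C\Big(\frac{a(x)}{l(t)\,\ell(t)}+\frac{t^{\varepsilon}}{\ell(t)}\Big).$$ -/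

import Mathlib

open Filter Topology MeasureTheory ProbabilityTheory

noncomputable section

namespace HeavyTailedWalk

/-! ### Jump kernels -/

/-- `L : [0,∞) → (0,∞)` is slowly varying. (Only the values on `[0,∞)` matter.) -/
def SlowlyVarying (L : ℝ → ℝ) : Prop :=
  (∀ x, 0 ≤ x → 0 < L x) ∧
    ∀ c : ℝ, 0 < c → Tendsto (fun x => L (c * x) / L x) atTop (𝓝 1)

/-- The two-sided tail `∑_{|y| ≥ x} p(y)` of a jump kernel on `ℤ`. -/
def tail (p : PMF ℤ) (x : ℝ) : ℝ :=
  (∑' y : {y : ℤ // x ≤ |(y : ℝ)|}, p y).toReal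

/-- The standing assumptions on the jump kernel: `p(0) = 0`, symmetry, aperiodicity (the support
of `p` generates the group `ℤ`), and `∑_{|y| ≥ x} p(y) = L(x) x^{-α} (1 + o(1))` as `x → ∞` with a
slowly varying function `L`. -/
structure IsHeavyTailedKernel (α : ℝ) (p : PMF ℤ) : Prop where
  zero : p 0 = 0
  symm : ∀ x : ℤ, p (-x) = p x
  aperiodic : AddSubgroup.closure {x : ℤ | p x ≠ 0} = ⊤
  tail_asymp : ∃ L : ℝ → ℝ, SlowlyVarying L ∧
    Tendsto (fun x : ℝ => tail p x / (L x / x ^ α)) atTop (𝓝 1)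

/-! ### The rate one continuous-time random walk with jump kernel `p` -/

/-- The sample space: `ω n = (n-th waiting time, n-th jump)`. -/
abbrev Path : Type := ℕ → ℝ × ℤ

/-- The law of the driving sequence: all coordinates are independent, the waiting times are
exponential with parameter `1`, and the jumps have law `p`. -/
def walkMeasure (p : PMF ℤ) : Measure Path :=
  Measure.infinitePi fun _ : ℕ => (expMeasure 1).prod p.toMeasure

/-- The time of the `(n+1)`-st jump. -/
def jumpTime (ω : Path) (n : ℕ) : ℝ := ∑ i ∈ Finset.range (n + 1), (ω i).1

/-- The number of jumps in `[0,t]` (almost surely finite). -/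
def jumpCount (ω : Path) (t : ℝ) : ℕ := {n : ℕ | jumpTime ω n ≤ t}.ncard

/-- The walk `X^x_t` started from `x`. -/
def walk (x : ℤ) (ω : Path) (t : ℝ) : ℤ := x + ∑ i ∈ Finset.range (jumpCount ω t), (ω i).2

/-- The transition probability `ℙ(X^x_t = y)`. -/
def transProb (p : PMF ℤ) (x : ℤ) (t : ℝ) (y : ℤ) : ℝ :=
  (walkMeasure p).real {ω | walk x ω t = y}

/-- The first hitting time of `0`,
`τ_x = inf {t : X^x_t = 0 and X^x_s ≠ 0 for some 0 < s < t}`, with `inf ∅ = ∞`. -/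
def hitTime (x : ℤ) (ω : Path) : EReal :=
  sInf ((fun t : ℝ => (t : EReal)) ''
    {t : ℝ | 0 ≤ t ∧ walk x ω t = 0 ∧ ∃ s : ℝ, 0 < s ∧ s < t ∧ walk x ω s ≠ 0})

/-- `ℙ(τ_x > t)`. -/
def hitTail (p : PMF ℤ) (x : ℤ) (t : ℝ) : ℝ :=
  (walkMeasure p).real {ω | (t : EReal) < hitTime x ω}

/-! ### The limiting stable density and the scaling functions -/

/-- The constant `γ` in the characteristic function `exp(-γ|u|^α)` of the limiting stable law. -/
def stableScale (α : ℝ) : ℝ :=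
  if α = 1 then Real.pi / 2 else Real.cos (Real.pi * α / 2) * Real.Gamma (1 - α)

/-- The density `g_α` of the symmetric stable law with characteristic function `exp(-γ|u|^α)`,
given by Fourier inversion (the imaginary part of the integral vanishes by symmetry). -/
def stableDensity (α x : ℝ) : ℝ :=
  (2 * Real.pi)⁻¹ * ∫ u : ℝ, Real.cos (u * x) * Real.exp (-stableScale α * |u| ^ α)

/-- `B_t = g_α(0) / ℙ(X_t = 0)`. -/
def scaleB (α : ℝ) (p : PMF ℤ) (t : ℝ) : ℝ := (transProb p 0 t 0)⁻¹ * stableDensity α 0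

/-- The Green function `G(x,t) = ∫_0^t ℙ(X_s = x) ds`. -/
def green (p : PMF ℤ) (x : ℤ) (t : ℝ) : ℝ := ∫ s in (0 : ℝ)..t, transProb p 0 s x

/-- `l(t) = G(0,t) / g_α(0) = ∫_0^t 1/B_s ds`. -/
def smallL (α : ℝ) (p : PMF ℤ) (t : ℝ) : ℝ := green p 0 t / stableDensity α 0

/-- `ℓ(t) = B_t l(t) / t`. -/
def ellFun (α : ℝ) (p : PMF ℤ) (t : ℝ) : ℝ := scaleB α p t * smallL α p t / t

/-! ### The potential kernel -/

/-- `a(x,t) = ∫_0^t (ℙ(X^0_s = 0) - ℙ(X^x_s = 0)) ds`. -/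
def potKernelUpTo (p : PMF ℤ) (x : ℤ) (t : ℝ) : ℝ :=
  ∫ s in (0 : ℝ)..t, (transProb p 0 s 0 - transProb p x s 0)

/-- The potential kernel `a(x) = lim_{t → ∞} a(x,t)`. -/
def potKernel (p : PMF ℤ) (x : ℤ) : ℝ := limUnder atTop (potKernelUpTo p x)

end HeavyTailedWalk

end

namespace HeavyTailedWalk

noncomputable section

open Set
open scoped Nat ENNReal BoundedContinuousFunction

/-! Write `u(t)` for the probability that the walk from `0` is at `0` at time `t`, `G(t)` for its
integral over `[0,t]`, `S(t,x)` for the survival probability and `a(x,t)` for the truncated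
potential kernel. Everything rests on the renewal identity `a(x,t) = ∫_0^t u(t-s) S(s,x) ds`
(`integral_retProb_sub`). As `g_α(0) l(t) = G(t)` and `ℓ(t) = G(t) / (t u(t))`, the claim is that
`S(t,x)` equals `a(x)/G(t)` up to a relative error of order `t u(t)/G(t)` and a truncation error
`(a(x) - a(x,t))/G(t)`.

Upper bound: `S` decreases in time, so `G(t) S(t,x) ≤ a(x,t) ≤ a(x)`.

Lower bound: splitting the renewal integral at `t/2` gives `a(x,t) ≤ u(t/2) ∫_0^t S(s,x) ds + G(t)
S(t/2,x)`. Inserting `S ≤ a/G` and `∫ 1/G ≤ C t/G(t)`, the first term is `O(a(x) t u(t)/G(t))`. For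
the second, `S(t/4,y) - S(3t/4,y) = O(t u(t)/G(t))` uniformly in `y` (`surv_sub_mul_retGreen_le`),
and the Markov property at time `t/4` turns this into a bound on `S(t/2,x) - S(t,x)` with the extra
factor `S(t/4,x) ≤ C a(x)/G(t)`.

Truncation: Fourier inversion gives `u(r) - P(X^x_r = 0) ≤ C |x| r^(-3/2)`, hence `a(x) - a(x,t) ≤ C
|x| t^(-1/2)`, which serves `α = 1`. For `α < 1` the tail integral of `u` is `O(t u(t))`, which
gives an error `O(1/ℓ(t))`.

No local limit theorem enters. The analytic input is that the characteristic exponent at `1/x` is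
comparable to the tail at `x`; rescaling the Fourier integral then yields doubling and decay of `u`.
The path space is left early on: both probabilities become values of `exp(t(P-1))`, with `P` the
free or the killed one-step operator, because a walk observed at time `t` is a Poisson number of
steps. -/

/-! ### The jump probabilities as real numbers -/

/-- The jump kernel as a real-valued function. -/
def weight (p : PMF ℤ) (y : ℤ) : ℝ := (p y).toReal

lemma weight_nonneg (p : PMF ℤ) (y : ℤ) : 0 ≤ weight p y := ENNReal.toReal_nonneg

lemma hasSum_weight (p : PMF ℤ) : HasSum (weight p) 1 := by
  have h := ENNReal.hasSum_toReal (f := fun y => p y) (by rw [p.tsum_coe]; simp)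
  rwa [← ENNReal.tsum_toReal_eq (fun y => p.apply_ne_top y), p.tsum_coe] at h

lemma ofReal_weight (p : PMF ℤ) (y : ℤ) : ENNReal.ofReal (weight p y) = p y :=
  ENNReal.ofReal_toReal (p.apply_ne_top y)

lemma summable_weight_mul (p : PMF ℤ) {f : ℤ → ℝ} {M : ℝ} (hf : ∀ y, |f y| ≤ M) :
    Summable fun y => weight p y * f y := by
  refine Summable.of_norm_bounded ((hasSum_weight p).summable.mul_right M) fun y => ?_
  rw [Real.norm_eq_abs, abs_mul, abs_of_nonneg (weight_nonneg p y)]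
  exact mul_le_mul_of_nonneg_left (hf y) (weight_nonneg p y)

lemma abs_tsum_weight_mul_le (p : PMF ℤ) {f : ℤ → ℝ} {M : ℝ} (hf : ∀ y, |f y| ≤ M) :
    |∑' y, weight p y * f y| ≤ M := by
  have hs := ((hasSum_weight p).mul_right M)
  rw [one_mul] at hs
  rw [← Real.norm_eq_abs]
  refine tsum_of_norm_bounded hs fun y => ?_
  rw [Real.norm_eq_abs, abs_mul, abs_of_nonneg (weight_nonneg p y)]
  exact mul_le_mul_of_nonneg_left (hf y) (weight_nonneg p y)

/-! ### Bounded functions on `ℤ` -/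

/-- The Banach space of bounded real functions on `ℤ`. -/
def BddFun : Type := ℤ →ᵇ ℝ

namespace BddFun

instance : NormedAddCommGroup BddFun := inferInstanceAs (NormedAddCommGroup (ℤ →ᵇ ℝ))
instance : NormedSpace ℝ BddFun := inferInstanceAs (NormedSpace ℝ (ℤ →ᵇ ℝ))
instance : CompleteSpace BddFun := inferInstanceAs (CompleteSpace (ℤ →ᵇ ℝ))
instance : FunLike BddFun ℤ ℝ := inferInstanceAs (FunLike (ℤ →ᵇ ℝ) ℤ ℝ)

/-- The bounded function with the values of `f`. -/
def of (f : ℤ → ℝ) (M : ℝ) (h : ∀ x, |f x| ≤ M) : BddFun :=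
  BoundedContinuousFunction.ofNormedAddCommGroupDiscrete f M h

lemma of_apply (f : ℤ → ℝ) (M : ℝ) (h : ∀ x, |f x| ≤ M) (x : ℤ) : of f M h x = f x := rfl

@[ext] lemma ext {f g : BddFun} (h : ∀ x, f x = g x) : f = g := DFunLike.ext _ _ h

lemma add_apply (f g : BddFun) (x : ℤ) : (f + g) x = f x + g x := rfl
lemma smul_apply (c : ℝ) (f : BddFun) (x : ℤ) : (c • f) x = c * f x := rfl

lemma abs_apply_le_norm (f : BddFun) (x : ℤ) : |f x| ≤ ‖f‖ :=
  BoundedContinuousFunction.norm_coe_le_norm (α := ℤ) (β := ℝ) f x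

lemma norm_le {f : BddFun} {C : ℝ} (hC : 0 ≤ C) (h : ∀ x, |f x| ≤ C) : ‖f‖ ≤ C :=
  (BoundedContinuousFunction.norm_le (α := ℤ) (β := ℝ) (f := f) hC).2 h

/-- Evaluation at a point. -/
def eval (x : ℤ) : BddFun →L[ℝ] ℝ :=
  LinearMap.mkContinuous
    { toFun := fun f => f x, map_add' := fun _ _ => rfl, map_smul' := fun _ _ => rfl } 1
    fun f => by rw [one_mul]; exact abs_apply_le_norm f x

lemma eval_apply (x : ℤ) (f : BddFun) : eval x f = f x := rfl

end BddFun

/-! ### The one-step operator and its semigroup -/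

/-- The value at `x` of one step of the walk, killed when it starts outside of `g`. -/
def stepFun (p : PMF ℤ) (g : Set ℤ) (f : ℤ → ℝ) : ℤ → ℝ :=
  g.indicator fun x => ∑' z, weight p z * f (x + z)

lemma abs_stepFun_le (p : PMF ℤ) (g : Set ℤ) {f : ℤ → ℝ} {M : ℝ} (hM : 0 ≤ M)
    (hf : ∀ y, |f y| ≤ M) (x : ℤ) : |stepFun p g f x| ≤ M := by
  unfold stepFun
  by_cases hx : x ∈ g
  · rw [indicator_of_mem hx]
    exact abs_tsum_weight_mul_le p fun y => hf _
  · rw [indicator_of_notMem hx]; simpa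

/-- The one-step operator on bounded functions, killed outside of `g`. -/
def stepOp (p : PMF ℤ) (g : Set ℤ) : BddFun →L[ℝ] BddFun :=
  LinearMap.mkContinuous
    { toFun := fun f => BddFun.of (stepFun p g f) ‖f‖
        fun x => abs_stepFun_le p g (norm_nonneg f) (BddFun.abs_apply_le_norm f) x
      map_add' := fun f₁ f₂ => by
        ext x
        by_cases hx : x ∈ g
        · simp only [stepFun, BddFun.of_apply, BddFun.add_apply, indicator_of_mem hx, mul_add]
          exact (summable_weight_mul p fun y => BddFun.abs_apply_le_norm f₁ _).tsum_add
            (summable_weight_mul p fun y => BddFun.abs_apply_le_norm f₂ _)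
        · simp [stepFun, BddFun.of_apply, BddFun.add_apply, indicator_of_notMem hx]
      map_smul' := fun c f => by
        ext x
        by_cases hx : x ∈ g
        · simp only [stepFun, BddFun.of_apply, BddFun.smul_apply, indicator_of_mem hx,
            RingHom.id_apply, mul_left_comm _ c]
          exact tsum_mul_left
        · simp [stepFun, BddFun.of_apply, BddFun.smul_apply, indicator_of_notMem hx] }
    1 fun f => by
      rw [one_mul]
      exact BddFun.norm_le (norm_nonneg f) fun x =>
        abs_stepFun_le p g (norm_nonneg f) (BddFun.abs_apply_le_norm f) x

lemma stepOp_apply (p : PMF ℤ) (g : Set ℤ) (f : BddFun) (x : ℤ) :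
    stepOp p g f x = g.indicator (fun x => ∑' z, weight p z * f (x + z)) x := rfl

lemma stepOp_apply_of_mem (p : PMF ℤ) {g : Set ℤ} (f : BddFun) {x : ℤ} (hx : x ∈ g) :
    stepOp p g f x = ∑' z, weight p z * f (x + z) := by
  rw [stepOp_apply, indicator_of_mem hx]

lemma stepOp_apply_of_notMem (p : PMF ℤ) {g : Set ℤ} (f : BddFun) {x : ℤ} (hx : x ∉ g) :
    stepOp p g f x = 0 := by
  rw [stepOp_apply, indicator_of_notMem hx]

lemma stepOp_nonneg (p : PMF ℤ) (g : Set ℤ) {f : BddFun} (hf : ∀ x, 0 ≤ f x) (x : ℤ) :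
    0 ≤ stepOp p g f x := by
  rw [stepOp_apply]
  exact indicator_nonneg (fun x _ => tsum_nonneg fun z => mul_nonneg (weight_nonneg p z) (hf _)) x

/-- The indicator of `b` as a bounded function. -/
def indBdd (b : Set ℤ) : BddFun :=
  BddFun.of (b.indicator 1) 1 fun x => by
    by_cases hx : x ∈ b <;> simp [hx]

lemma indBdd_apply (b : Set ℤ) (x : ℤ) : indBdd b x = b.indicator 1 x := rfl

lemma indBdd_nonneg (b : Set ℤ) (x : ℤ) : 0 ≤ indBdd b x := by
  rw [indBdd_apply]; exact indicator_nonneg (fun _ _ => zero_le_one) x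

lemma pow_stepOp_succ (p : PMF ℤ) (g : Set ℤ) (n : ℕ) (f : BddFun) :
    (stepOp p g ^ (n + 1)) f = stepOp p g ((stepOp p g ^ n) f) := by
  rw [pow_succ']; rfl

lemma pow_stepOp_nonneg (p : PMF ℤ) (g : Set ℤ) {f : BddFun} (hf : ∀ x, 0 ≤ f x) (n : ℕ) :
    ∀ x, 0 ≤ (stepOp p g ^ n) f x := by
  induction n with
  | zero => simpa using hf
  | succ n ih =>
    intro x
    rw [pow_stepOp_succ]
    exact stepOp_nonneg p g ih x

/-- The semigroup of the rate one walk that is killed when it jumps from outside of `g`. -/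
def semigroup (p : PMF ℤ) (g : Set ℤ) (t : ℝ) : BddFun →L[ℝ] BddFun :=
  NormedSpace.exp (t • (stepOp p g - 1))

/-- The identity commutes with everything, so `exp(t(P-1)) = e^(-t) exp(tP)`. The resulting series
weights the `n`-step operator with the Poisson probability of `n` jumps, which is the link to the
path space. -/
lemma hasSum_semigroup (p : PMF ℤ) (g : Set ℤ) (t : ℝ) (f : BddFun) (x : ℤ) :
    HasSum (fun n : ℕ => Real.exp (-t) * t ^ n / n ! * (stepOp p g ^ n) f x)
      (semigroup p g t f x) := by
  have hexp : semigroup p g t = Real.exp (-t) • NormedSpace.exp (t • stepOp p g) := by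
    have hc : Commute (t • stepOp p g) ((-t) • (1 : BddFun →L[ℝ] BddFun)) :=
      (Commute.one_right _).smul_right _
    have h1 : NormedSpace.exp ((-t) • (1 : BddFun →L[ℝ] BddFun)) =
        Real.exp (-t) • (1 : BddFun →L[ℝ] BddFun) := by
      rw [← Algebra.algebraMap_eq_smul_one, ← Algebra.algebraMap_eq_smul_one,
        Real.exp_eq_exp_ℝ, NormedSpace.algebraMap_exp_comm]
    let _ := NormedAlgebra.restrictScalars ℚ ℝ (BddFun →L[ℝ] BddFun)
    unfold semigroup
    rw [smul_sub, sub_eq_add_neg, ← neg_smul, NormedSpace.exp_add_of_commute hc, h1,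
      mul_smul_comm, mul_one]
  have h := NormedSpace.exp_series_hasSum_exp' (𝕂 := ℝ) (t • stepOp p g)
  let ev : (BddFun →L[ℝ] BddFun) →L[ℝ] ℝ :=
    (BddFun.eval x).comp (ContinuousLinearMap.apply ℝ BddFun f)
  have h2 := (h.const_smul (Real.exp (-t))).mapL ev
  rw [← hexp] at h2
  change HasSum _ (ev (semigroup p g t))
  convert h2 using 2 with n
  simp [ev, smul_pow, BddFun.eval_apply]
  ring

lemma semigroup_nonneg (p : PMF ℤ) (g : Set ℤ) {t : ℝ} (ht : 0 ≤ t) {f : BddFun}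
    (hf : ∀ x, 0 ≤ f x) (x : ℤ) : 0 ≤ semigroup p g t f x :=
  (hasSum_semigroup p g t f x).nonneg fun n =>
    mul_nonneg (by positivity) (pow_stepOp_nonneg p g hf n x)

lemma semigroup_add (p : PMF ℤ) (g : Set ℤ) (s t : ℝ) :
    semigroup p g (s + t) = semigroup p g s * semigroup p g t := by
  let _ := NormedAlgebra.restrictScalars ℚ ℝ (BddFun →L[ℝ] BddFun)
  unfold semigroup
  rw [add_smul, NormedSpace.exp_add_of_commute]
  exact ((Commute.refl _).smul_left _).smul_right _

lemma semigroup_zero (p : PMF ℤ) (g : Set ℤ) : semigroup p g 0 = 1 := by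
  simp [semigroup]

lemma hasDerivAt_semigroup (p : PMF ℤ) (g : Set ℤ) (t : ℝ) :
    HasDerivAt (semigroup p g) (semigroup p g t * (stepOp p g - 1)) t :=
  hasDerivAt_exp_smul_const (𝕂 := ℝ) (stepOp p g - 1) t

lemma hasDerivAt_semigroup' (p : PMF ℤ) (g : Set ℤ) (t : ℝ) :
    HasDerivAt (semigroup p g) ((stepOp p g - 1) * semigroup p g t) t :=
  hasDerivAt_exp_smul_const' (𝕂 := ℝ) (stepOp p g - 1) t

lemma continuous_semigroup (p : PMF ℤ) (g : Set ℤ) : Continuous (semigroup p g) :=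
  continuous_iff_continuousAt.2 fun t => (hasDerivAt_semigroup p g t).continuousAt

/-! ### The driving sequence -/

instance : IsProbabilityMeasure (expMeasure 1) := isProbabilityMeasure_expMeasure one_pos

/-- The law of one waiting time together with one jump. -/
abbrev stepLaw (p : PMF ℤ) : Measure (ℝ × ℤ) := (expMeasure 1).prod p.toMeasure

instance (p : PMF ℤ) : IsProbabilityMeasure (walkMeasure p) := by
  unfold walkMeasure; infer_instance

/-- Prepend one waiting time and jump to a driving sequence. -/
def consPath (z : ℝ × ℤ) (ω : Path) : Path
  | 0 => z
  | n + 1 => ω n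

lemma measurable_consPath :
    Measurable fun q : (ℝ × ℤ) × Path => consPath q.1 q.2 := by
  refine measurable_pi_lambda _ fun n => ?_
  cases n with
  | zero => exact measurable_fst
  | succ n => exact (measurable_pi_apply n).comp measurable_snd

/-- An i.i.d. sequence keeps its law when an independent copy of one coordinate is put in front.
This is the form in which the walk is conditioned on its first waiting time and jump. -/
lemma map_consPath (p : PMF ℤ) :
    ((stepLaw p).prod (walkMeasure p)).map (fun q => consPath q.1 q.2) = walkMeasure p := by
  refine Measure.eq_infinitePi _ fun s t ht => ?_
  obtain ⟨n, hn⟩ : ∃ n, s ⊆ Finset.range (n + 1) :=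
    ⟨s.sup id, fun i hi => Finset.mem_range.2 (Nat.lt_succ_of_le (Finset.le_sup (f := id) hi))⟩
  classical
  -- Padding the cylinder by `univ` makes it a full box over the first `n + 1` coordinates, from
  -- which coordinate `0` splits off.
  set t' : ℕ → Set (ℝ × ℤ) := fun i => if i ∈ s then t i else univ with ht'
  have hmt' : ∀ i, MeasurableSet (t' i) := fun i => by
    simp only [ht']; split_ifs
    · exact ht i
    · exact .univ
  have hpre : (fun q : (ℝ × ℤ) × Path => consPath q.1 q.2) ⁻¹' (Set.pi s t) =
      t' 0 ×ˢ Set.pi (Finset.range n : Set ℕ) (fun i => t' (i + 1)) := by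
    ext q
    simp only [mem_preimage, Set.mem_pi, Finset.mem_coe, mem_prod, Finset.mem_range]
    constructor
    · intro h
      refine ⟨?_, fun i _ => ?_⟩
      · simp only [ht']; split_ifs with h0
        · exact h 0 h0
        · trivial
      · simp only [ht']; split_ifs with h0
        · exact h (i + 1) h0
        · trivial
    · rintro ⟨h0, h1⟩ i hi
      cases i with
      | zero => simpa [ht', hi, consPath] using h0
      | succ i =>
        have := h1 i (by have := Finset.mem_range.1 (hn hi); omega)
        simpa [ht', hi, consPath] using this
  rw [Measure.map_apply measurable_consPath (.pi s.countable_toSet fun i _ => ht i), hpre,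
    Measure.prod_prod, walkMeasure, Measure.infinitePi_pi _ (fun i _ => hmt' (i + 1)), mul_comm,
    ← Finset.prod_range_succ' (fun i => stepLaw p (t' i))]
  rw [← Finset.prod_subset hn (fun i _ hi => by simp [ht', hi])]
  exact Finset.prod_congr rfl fun i hi => by simp [ht', hi]

/-- The time of the `n`-th jump (with `arrival ω 0 = 0`). -/
def arrival (ω : Path) (n : ℕ) : ℝ := ∑ i ∈ Finset.range n, (ω i).1

/-- The position after `n` jumps. -/
def position (x : ℤ) (ω : Path) (n : ℕ) : ℤ := x + ∑ i ∈ Finset.range n, (ω i).2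

lemma arrival_consPath (z : ℝ × ℤ) (ω : Path) (n : ℕ) :
    arrival (consPath z ω) (n + 1) = z.1 + arrival ω n := by
  simp [arrival, Finset.sum_range_succ', consPath, add_comm]

lemma position_consPath (x : ℤ) (z : ℝ × ℤ) (ω : Path) (n : ℕ) :
    position x (consPath z ω) (n + 1) = position (x + z.2) ω n := by
  simp [position, Finset.sum_range_succ', consPath]; ring

lemma measurable_arrival (n : ℕ) : Measurable fun ω : Path => arrival ω n :=
  Finset.measurable_sum _ fun i _ => measurable_fst.comp (measurable_pi_apply i)

lemma measurable_position (x : ℤ) (n : ℕ) : Measurable fun ω : Path => position x ω n :=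
  measurable_const.add
    (Finset.measurable_sum _ fun i _ => measurable_snd.comp (measurable_pi_apply i))

/-- Exactly `n` jumps occur until time `t`, the walk visits `g` before the last of them and
`b` after it. -/
def skeletonEvent (b g : Set ℤ) (n : ℕ) (t : ℝ) (x : ℤ) : Set Path :=
  {ω | arrival ω n ≤ t ∧ t < arrival ω (n + 1) ∧ position x ω n ∈ b ∧
    ∀ k < n, position x ω k ∈ g}

lemma measurableSet_skeletonEvent (b g : Set ℤ) (n : ℕ) (t : ℝ) (x : ℤ) :
    MeasurableSet (skeletonEvent b g n t x) := by
  refine (measurableSet_le (measurable_arrival n) measurable_const).inter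
    ((measurableSet_lt measurable_const (measurable_arrival (n + 1))).inter
      (((measurable_position x n) (.of_discrete (s := b))).inter ?_))
  have : {ω : Path | ∀ k < n, position x ω k ∈ g} =
      ⋂ k, ⋂ _ : k < n, {ω | position x ω k ∈ g} := by
    ext; simp
  change MeasurableSet {ω : Path | ∀ k < n, position x ω k ∈ g}
  rw [this]
  exact MeasurableSet.iInter fun k => MeasurableSet.iInter fun _ =>
    (measurable_position x k) (.of_discrete (s := g))

lemma consPath_mem_skeletonEvent {b g : Set ℤ} {n : ℕ} {t : ℝ} {x : ℤ} {z : ℝ × ℤ} {ω : Path} :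
    consPath z ω ∈ skeletonEvent b g (n + 1) t x ↔
      x ∈ g ∧ ω ∈ skeletonEvent b g n (t - z.1) (x + z.2) := by
  have h0 : position x (consPath z ω) 0 = x := by simp [position]
  simp only [skeletonEvent, mem_ofPred_eq, arrival_consPath, position_consPath,
    Nat.forall_lt_succ_left', h0, le_sub_iff_add_le', sub_lt_iff_lt_add']
  tauto

/-- The Poisson weights, extended by zero to negative times. -/
def poissonWeight (n : ℕ) (t : ℝ) : ℝ := if 0 ≤ t then Real.exp (-t) * t ^ n / n ! else 0

lemma poissonWeight_nonneg (n : ℕ) (t : ℝ) : 0 ≤ poissonWeight n t := by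
  unfold poissonWeight; split_ifs <;> positivity

lemma measurable_poissonWeight (n : ℕ) : Measurable (poissonWeight n) :=
  Measurable.ite measurableSet_Ici (by fun_prop) measurable_const

/-- The factors `e^(-s)` and `e^(-(t-s))` combine to `e^(-t)`, leaving the integral of `(t-s)^n`
over `[0,t]`. Extending the weights by zero makes this valid for negative `t` too, as the induction
below requires. -/
lemma lintegral_poissonWeight (n : ℕ) (t : ℝ) :
    ∫⁻ s, ENNReal.ofReal (poissonWeight n (t - s)) ∂(expMeasure 1) =
      ENNReal.ofReal (poissonWeight (n + 1) t) := by
  have hm : Measurable fun s => ENNReal.ofReal (poissonWeight n (t - s)) :=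
    ((measurable_poissonWeight n).comp (measurable_const.sub measurable_id)).ennreal_ofReal
  have h1 : expMeasure 1 = volume.withDensity (exponentialPDF 1) := rfl
  have h2 : ∀ s, (exponentialPDF 1 * fun s => ENNReal.ofReal (poissonWeight n (t - s))) s =
      (Icc 0 t).indicator
        (fun s => ENNReal.ofReal (Real.exp (-t) / n ! * (t - s) ^ n)) s := by
    intro s
    simp only [Pi.mul_apply, exponentialPDF_eq, poissonWeight, indicator, mem_Icc, sub_nonneg,
      one_mul]
    by_cases hs : 0 ≤ s
    · by_cases hst : s ≤ t
      · rw [if_pos hs, if_pos hst, if_pos ⟨hs, hst⟩, ← ENNReal.ofReal_mul (Real.exp_pos _).le]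
        congr 1
        have : Real.exp (-t) = Real.exp (-s) * Real.exp (-(t - s)) := by
          rw [← Real.exp_add]; congr 1; ring
        rw [this]; ring
      · simp [hst]
    · simp [hs]
  rw [h1, lintegral_withDensity_eq_lintegral_mul _
    (f := exponentialPDF 1) (measurable_exponentialPDFReal 1).ennreal_ofReal hm, lintegral_congr h2,
    lintegral_indicator measurableSet_Icc]
  by_cases ht : 0 ≤ t
  · rw [← ofReal_integral_eq_lintegral_ofReal]
    · congr 1
      rw [integral_Icc_eq_integral_Ioc, ← intervalIntegral.integral_of_le ht,
        intervalIntegral.integral_const_mul,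
        intervalIntegral.integral_comp_sub_left (fun s => s ^ n) t, integral_pow,
        poissonWeight, if_pos ht, Nat.factorial_succ]
      have : (n ! : ℝ) ≠ 0 := by positivity
      push_cast
      field_simp
      simp
    · exact (Continuous.continuousOn (by fun_prop)).integrableOn_Icc
    · filter_upwards [ae_restrict_mem measurableSet_Icc] with s hs
      have : 0 ≤ t - s := sub_nonneg.2 hs.2
      positivity
  · simp [poissonWeight, ht]

lemma expMeasure_Ioi {t : ℝ} (ht : 0 ≤ t) :
    expMeasure 1 (Ioi t) = ENNReal.ofReal (Real.exp (-t)) := by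
  have h := cdf_expMeasure_eq one_pos t
  rw [if_pos ht, one_mul, cdf_eq_real] at h
  rw [← compl_Iic, ← ofReal_measureReal, probReal_compl_eq_one_sub measurableSet_Iic, h]
  congr 1; ring

/-- Induction by the first step: waiting time and jump are independent, so the integral factorises.
The waiting time raises the Poisson index by one, and the jump applies the step operator once more.
Time and starting point are generalised since both change. -/
lemma walkMeasure_skeletonEvent (p : PMF ℤ) (b g : Set ℤ) (n : ℕ) (t : ℝ) (x : ℤ) :
    walkMeasure p (skeletonEvent b g n t x) =
      ENNReal.ofReal (poissonWeight n t * (stepOp p g ^ n) (indBdd b) x) := by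
  induction n generalizing t x with
  | zero =>
    by_cases hx : x ∈ b ∧ 0 ≤ t
    · have : skeletonEvent b g 0 t x = (fun ω : Path => ω 0) ⁻¹' (Ioi t ×ˢ univ) := by
        ext ω
        simp [skeletonEvent, arrival, position, hx.1, hx.2]
      rw [this, walkMeasure, (measurePreserving_eval_infinitePi
          (fun _ : ℕ => stepLaw p) 0).measure_preimage
        (measurableSet_Ioi.prod .univ).nullMeasurableSet, Measure.prod_prod, expMeasure_Ioi hx.2]
      simp [poissonWeight, hx.2, indBdd_apply, hx.1]
    · have : skeletonEvent b g 0 t x = ∅ := by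
        ext ω
        simp only [skeletonEvent, arrival, position, Finset.range_zero, Finset.sum_empty,
          add_zero, mem_ofPred_eq, mem_empty_iff_false, iff_false]
        tauto
      rw [this, measure_empty]
      rcases not_and_or.1 hx with h | h
      · simp [indBdd_apply, h]
      · simp [poissonWeight, h]
  | succ n ih =>
    rw [← map_consPath p, Measure.map_apply measurable_consPath
      (measurableSet_skeletonEvent b g _ t x), Measure.prod_apply
      (measurable_consPath (measurableSet_skeletonEvent b g _ t x))]
    have hset : ∀ z : ℝ × ℤ, Prod.mk z ⁻¹' ((fun q : (ℝ × ℤ) × Path => consPath q.1 q.2) ⁻¹'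
        skeletonEvent b g (n + 1) t x) =
        {ω | x ∈ g ∧ ω ∈ skeletonEvent b g n (t - z.1) (x + z.2)} := fun z => by
      ext ω; exact consPath_mem_skeletonEvent
    simp only [hset]
    by_cases hx : x ∈ g
    · have hnn : ∀ y, 0 ≤ (stepOp p g ^ n) (indBdd b) y :=
        pow_stepOp_nonneg p g (indBdd_nonneg b) n
      have hval : ∀ z : ℝ × ℤ,
          walkMeasure p {ω | x ∈ g ∧ ω ∈ skeletonEvent b g n (t - z.1) (x + z.2)} =
          ENNReal.ofReal (poissonWeight n (t - z.1)) *
            ENNReal.ofReal ((stepOp p g ^ n) (indBdd b) (x + z.2)) := fun z => by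
        simp only [hx, true_and, ofPred_mem_eq]
        rw [ih, ENNReal.ofReal_mul (poissonWeight_nonneg _ _)]
      simp only [hval]
      rw [lintegral_prod_mul
        (f := fun s => ENNReal.ofReal (poissonWeight n (t - s)))
        (g := fun z => ENNReal.ofReal ((stepOp p g ^ n) (indBdd b) (x + z)))
        ((measurable_poissonWeight n).comp
          (measurable_const.sub measurable_id)).ennreal_ofReal.aemeasurable
        (Measurable.of_discrete).aemeasurable, lintegral_poissonWeight,
        ENNReal.ofReal_mul (poissonWeight_nonneg _ _), lintegral_countable', pow_stepOp_succ,
        stepOp_apply_of_mem p _ hx,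
        ENNReal.ofReal_tsum_of_nonneg (fun z => mul_nonneg (weight_nonneg p z) (hnn _))
          (summable_weight_mul p fun y => BddFun.abs_apply_le_norm _ _)]
      congr 2
      ext z
      rw [ENNReal.ofReal_mul (weight_nonneg p z), ofReal_weight,
        PMF.toMeasure_apply_singleton _ _ (measurableSet_singleton z), mul_comm]
    · have : (stepOp p g ^ (n + 1)) (indBdd b) x = 0 := by
        rw [pow_stepOp_succ]; exact stepOp_apply_of_notMem p _ hx
      rw [this]
      simp [hx]

/-! ### Transition probabilities and hitting times through the semigroups -/

lemma ae_waiting_pos (p : PMF ℤ) : ∀ᵐ ω ∂walkMeasure p, ∀ n, 0 < (ω n).1 := by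
  refine ae_all_iff.2 fun n => ?_
  have h0 : expMeasure 1 (Iic 0) = 0 := by
    rw [← compl_Ioi, prob_compl_eq_zero_iff measurableSet_Ioi, expMeasure_Ioi le_rfl]
    simp
  have h1 : {ω : Path | ¬ 0 < (ω n).1} = (fun ω : Path => ω n) ⁻¹' (Iic 0 ×ˢ univ) := by
    ext ω; simp
  rw [ae_iff, h1, walkMeasure, (measurePreserving_eval_infinitePi
    (fun _ : ℕ => stepLaw p) n).measure_preimage
    (measurableSet_Iic.prod .univ).nullMeasurableSet, Measure.prod_prod, h0, zero_mul]

lemma strictMono_arrival {ω : Path} (h : ∀ n, 0 < (ω n).1) : StrictMono (arrival ω) :=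
  strictMono_nat_of_lt_succ fun n => by
    simp only [arrival, Finset.sum_range_succ]; linarith [h n]

lemma eq_of_arrival {ω : Path} (h : StrictMono (arrival ω)) {t : ℝ} {m n : ℕ}
    (hm : arrival ω m ≤ t) (hm' : t < arrival ω (m + 1)) (hn : arrival ω n ≤ t)
    (hn' : t < arrival ω (n + 1)) : m = n := by
  have h1 := h.lt_iff_lt.1 (hm.trans_lt hn')
  have h2 := h.lt_iff_lt.1 (hn.trans_lt hm')
  omega

lemma walkMeasure_iUnion_skeletonEvent (p : PMF ℤ) (b g : Set ℤ) {t : ℝ} (ht : 0 ≤ t) (x : ℤ) :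
    walkMeasure p (⋃ n, skeletonEvent b g n t x) =
      ENNReal.ofReal (semigroup p g t (indBdd b) x) := by
  have hd : Pairwise (Function.onFun (AEDisjoint (walkMeasure p))
      fun n => skeletonEvent b g n t x) := by
    intro m n hmn
    refine measure_mono_null ?_ (ae_iff.1 (ae_waiting_pos p))
    rintro ω ⟨h1, h2⟩ hω
    exact hmn (eq_of_arrival (strictMono_arrival hω) h1.1 h1.2.1 h2.1 h2.2.1)
  have hs := hasSum_semigroup p g t (indBdd b) x
  rw [measure_iUnion₀ hd fun n => (measurableSet_skeletonEvent b g n t x).nullMeasurableSet,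
    ← hs.tsum_eq, ENNReal.ofReal_tsum_of_nonneg (fun n => mul_nonneg (by positivity)
      (pow_stepOp_nonneg p g (indBdd_nonneg b) n x)) hs.summable]
  refine tsum_congr fun n => ?_
  rw [walkMeasure_skeletonEvent, poissonWeight, if_pos ht]

lemma stepOp_univ_one (p : PMF ℤ) : stepOp p univ (indBdd univ) = indBdd univ := by
  ext x
  rw [stepOp_apply_of_mem p _ (mem_univ x)]
  simp [indBdd_apply, (hasSum_weight p).tsum_eq]

lemma semigroup_univ_one (p : PMF ℤ) (t : ℝ) :
    semigroup p univ t (indBdd univ) = indBdd univ := by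
  ext x
  have hpow : ∀ n : ℕ, (stepOp p univ ^ n) (indBdd univ) = indBdd univ := fun n => by
    induction n with
    | zero => rfl
    | succ n ih => rw [pow_stepOp_succ, ih, stepOp_univ_one]
  have h := hasSum_semigroup p univ t (indBdd univ) x
  simp only [hpow] at h
  have h2 : HasSum (fun n : ℕ => Real.exp (-t) * t ^ n / n ! * indBdd univ x)
      (Real.exp (-t) * Real.exp t * indBdd univ x) := by
    refine HasSum.mul_right _ ?_
    have h3 := NormedSpace.expSeries_div_hasSum_exp (𝔸 := ℝ) t
    rw [← Real.exp_eq_exp_ℝ] at h3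
    simpa only [mul_div_assoc] using h3.mul_left (Real.exp (-t))
  rw [h.unique h2, ← Real.exp_add]
  simp

/-- Non-explosion comes from conservation of mass: with no restriction on positions, the events of
having exactly `n` jumps have total mass given by the semigroup at the constant `1`, which it fixes.
-/
lemma ae_exists_arrival (p : PMF ℤ) {t : ℝ} (ht : 0 ≤ t) :
    ∀ᵐ ω ∂walkMeasure p, ∃ n, arrival ω n ≤ t ∧ t < arrival ω (n + 1) := by
  have h := walkMeasure_iUnion_skeletonEvent p univ univ ht 0
  rw [semigroup_univ_one] at h
  have h1 : indBdd univ 0 = 1 := by simp [indBdd_apply]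
  rw [h1, ENNReal.ofReal_one] at h
  have h2 := (prob_compl_eq_zero_iff
    (MeasurableSet.iUnion fun n => measurableSet_skeletonEvent univ univ n t 0)).2 h
  refine (measure_eq_zero_iff_ae_notMem.1 h2).mono fun ω hω => ?_
  simp only [mem_compl_iff, not_not, mem_iUnion] at hω
  exact hω.imp fun n hn => ⟨hn.1, hn.2.1⟩

/-- Transfers to the semigroup any event that the positions up to the last jump before `t` decide,
off the null set where waiting times vanish or the walk explodes. -/
lemma measureReal_eq_semigroup (p : PMF ℤ) (b g : Set ℤ) {t : ℝ} (ht : 0 ≤ t) (x : ℤ)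
    {S : Set Path} (hS : ∀ ω : Path, StrictMono (arrival ω) → ∀ n, arrival ω n ≤ t →
      t < arrival ω (n + 1) → (ω ∈ S ↔ position x ω n ∈ b ∧ ∀ k < n, position x ω k ∈ g)) :
    (walkMeasure p).real S = semigroup p g t (indBdd b) x := by
  have hae : S =ᵐ[walkMeasure p] ⋃ n, skeletonEvent b g n t x := by
    filter_upwards [ae_waiting_pos p, ae_exists_arrival p ht] with ω hω ⟨n, h1, h2⟩
    have hmono := strictMono_arrival hω
    refine propext ((hS ω hmono n h1 h2).trans ?_)
    change _ ↔ ω ∈ ⋃ n, skeletonEvent b g n t x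
    rw [mem_iUnion]
    constructor
    · exact fun h => ⟨n, h1, h2, h⟩
    · rintro ⟨m, h3, h4, h⟩
      rwa [eq_of_arrival hmono h3 h4 h1 h2] at h
  rw [Measure.real, measure_congr hae, walkMeasure_iUnion_skeletonEvent p b g ht,
    ENNReal.toReal_ofReal (semigroup_nonneg p g ht (indBdd_nonneg b) x)]

lemma walk_eq_position {ω : Path} (h : StrictMono (arrival ω)) {t : ℝ} {n : ℕ}
    (h1 : arrival ω n ≤ t) (h2 : t < arrival ω (n + 1)) (x : ℤ) :
    walk x ω t = position x ω n := by
  -- `jumpTime ω m` is `arrival ω (m + 1)`, so exactly the indices below `n` are counted.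
  have hset : {m : ℕ | jumpTime ω m ≤ t} = ((Finset.range n : Finset ℕ) : Set ℕ) := by
    ext m
    simp only [mem_ofPred_eq, Finset.coe_range, mem_Iio]
    change arrival ω (m + 1) ≤ t ↔ _
    constructor
    · intro hm
      have := h.lt_iff_lt.1 (hm.trans_lt h2)
      omega
    · intro hm
      exact (h.monotone (by omega : m + 1 ≤ n)).trans h1
  rw [walk, jumpCount, hset, ncard_coe_finset, Finset.card_range, position]

lemma exists_arrival_of_lt {ω : Path} {s : ℝ} {n : ℕ} (hs : 0 ≤ s) (h : s < arrival ω n) :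
    ∃ m < n, arrival ω m ≤ s ∧ s < arrival ω (m + 1) := by
  induction n with
  | zero => simp [arrival] at h; linarith
  | succ n ih =>
    by_cases h' : s < arrival ω n
    · obtain ⟨m, hm, h1⟩ := ih h'
      exact ⟨m, by omega, h1⟩
    · exact ⟨n, by omega, not_lt.1 h', h⟩

lemma lt_hitTime_iff {ω : Path} (h : StrictMono (arrival ω)) {t : ℝ} {n : ℕ}
    (h1 : arrival ω n ≤ t) (h2 : t < arrival ω (n + 1)) {x : ℤ} (hx : x ≠ 0) :
    (t : EReal) < hitTime x ω ↔ position x ω n ∈ ({0}ᶜ : Set ℤ) ∧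
      ∀ k < n, position x ω k ∈ ({0}ᶜ : Set ℤ) := by
  have harr0 : arrival ω 0 = 0 := by simp [arrival]
  have hpos0 : position x ω 0 = x := by simp [position]
  have key : (position x ω n ∈ ({0}ᶜ : Set ℤ) ∧ ∀ k < n, position x ω k ∈ ({0}ᶜ : Set ℤ)) ↔
      ∀ k ≤ n, position x ω k ≠ 0 := by
    constructor
    · rintro ⟨ha, hb⟩ k hk
      rcases hk.lt_or_eq with h | rfl
      · exact hb k h
      · exact ha
    · exact fun ha => ⟨ha n le_rfl, fun k hk => ha k hk.le⟩
  rw [key]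
  constructor
  · intro hlt k hk hk0
    have hkpos : 0 < k := Nat.pos_of_ne_zero fun hk' => hx (by rw [← hpos0, ← hk', hk0])
    have harr1 : 0 < arrival ω 1 := harr0 ▸ h one_pos
    have hle : arrival ω 1 ≤ arrival ω k := h.monotone hkpos
    have hmem : hitTime x ω ≤ (arrival ω k : EReal) := by
      -- Until the first jump the walk sits at `x ≠ 0`, so half the first arrival time witnesses
      -- that it was away from `0` before.
      refine sInf_le ⟨arrival ω k, ⟨by linarith, ?_, arrival ω 1 / 2, by linarith, by linarith,
        ?_⟩, rfl⟩
      · rw [walk_eq_position h le_rfl (h (Nat.lt_succ_self k)), hk0]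
      · rw [walk_eq_position (n := 0) h (by rw [harr0]; linarith) (by rw [zero_add]; linarith),
          hpos0]
        exact hx
    exact absurd hlt (not_lt.2 (hmem.trans (EReal.coe_le_coe_iff.2 ((h.monotone hk).trans h1))))
  · intro hne
    -- All hitting times are bounded below by the next arrival, which exceeds `t`; this keeps the
    -- inequality strict after the infimum.
    refine (EReal.coe_lt_coe_iff.2 h2).trans_le (le_sInf ?_)
    rintro _ ⟨s, ⟨hs0, hs, -⟩, rfl⟩
    refine EReal.coe_le_coe_iff.2 (not_lt.1 fun hlt => ?_)
    obtain ⟨m, hm, hm1, hm2⟩ := exists_arrival_of_lt hs0 hlt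
    rw [walk_eq_position h hm1 hm2] at hs
    exact hne m (by omega) hs

lemma transProb_eq_semigroup (p : PMF ℤ) (x : ℤ) {t : ℝ} (ht : 0 ≤ t) :
    transProb p x t 0 = semigroup p univ t (indBdd {0}) x := by
  refine measureReal_eq_semigroup p {0} univ ht x fun ω h n h1 h2 => ?_
  simp [walk_eq_position h h1 h2]

lemma hitTail_eq_semigroup (p : PMF ℤ) {x : ℤ} (hx : x ≠ 0) {t : ℝ} (ht : 0 ≤ t) :
    hitTail p x t = semigroup p {0}ᶜ t (indBdd {0}ᶜ) x :=
  measureReal_eq_semigroup p {0}ᶜ {0}ᶜ ht x fun _ h _ h1 h2 => lt_hitTime_iff h h1 h2 hx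

/-! ### Fourier inversion -/

lemma hasSum_of_eq {ι : Type*} {f f' : ι → ℝ} {a a' : ℝ} (h : HasSum f' a')
    (hf : ∀ i, f i = f' i) (ha : a = a') : HasSum f a := by
  rw [ha, funext hf]; exact h

/-- The characteristic exponent `ψ(u) = 1 - ∑ p(y) cos(uy)`. -/
def charExp (p : PMF ℤ) (u : ℝ) : ℝ := 1 - ∑' y : ℤ, weight p y * Real.cos (u * y)

lemma summable_weight_cos (p : PMF ℤ) (u : ℝ) :
    Summable fun y : ℤ => weight p y * Real.cos (u * y) :=
  summable_weight_mul p (M := 1) fun _ => Real.abs_cos_le_one _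

lemma hasSum_charExp (p : PMF ℤ) (u : ℝ) :
    HasSum (fun y : ℤ => weight p y * (1 - Real.cos (u * y))) (charExp p u) := by
  simp only [mul_sub, mul_one]
  exact (hasSum_weight p).sub (summable_weight_cos p u).hasSum

lemma charExp_nonneg (p : PMF ℤ) (u : ℝ) : 0 ≤ charExp p u :=
  (hasSum_charExp p u).nonneg fun y =>
    mul_nonneg (weight_nonneg p y) (sub_nonneg.2 (Real.cos_le_one _))

lemma charExp_le_two (p : PMF ℤ) (u : ℝ) : charExp p u ≤ 2 := by
  have := neg_le_of_abs_le (abs_tsum_weight_mul_le p (f := fun y : ℤ => Real.cos (u * y))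
    (M := 1) fun _ => Real.abs_cos_le_one _)
  unfold charExp; linarith

lemma charExp_zero (p : PMF ℤ) : charExp p 0 = 0 := by
  simp [charExp, (hasSum_weight p).tsum_eq]

lemma charExp_neg (p : PMF ℤ) (u : ℝ) : charExp p (-u) = charExp p u := by
  simp [charExp]

lemma continuous_charExp (p : PMF ℤ) : Continuous (charExp p) := by
  refine continuous_const.sub (continuous_tsum (fun y => by fun_prop)
    (hasSum_weight p).summable fun y u => ?_)
  rw [Real.norm_eq_abs, abs_mul, abs_of_nonneg (weight_nonneg p y)]
  exact mul_le_of_le_one_right (weight_nonneg p y) (Real.abs_cos_le_one _)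

lemma weight_neg {p : PMF ℤ} (hsymm : ∀ x : ℤ, p (-x) = p x) (y : ℤ) :
    weight p (-y) = weight p y := by rw [weight, hsymm, weight]

/-- By symmetry the sine part cancels, so the cosine of frequency `u` is an eigenfunction of the
free step operator with eigenvalue `1 - charExp p u`. -/
lemma tsum_weight_cos_add {p : PMF ℤ} (hsymm : ∀ x : ℤ, p (-x) = p x) (u : ℝ) (x : ℤ) :
    HasSum (fun z : ℤ => weight p z * Real.cos (u * (x + z : ℤ)))
      (Real.cos (u * x) * (1 - charExp p u)) := by
  have hsin : Summable fun y : ℤ => weight p y * Real.sin (u * y) :=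
    summable_weight_mul p (M := 1) fun _ => Real.abs_sin_le_one _
  have hzero : ∑' y : ℤ, weight p y * Real.sin (u * y) = 0 := by
    have h := (Equiv.neg ℤ).tsum_eq fun y : ℤ => weight p y * Real.sin (u * y)
    simp only [Equiv.neg_apply, weight_neg hsymm, Int.cast_neg, mul_neg, Real.sin_neg,
      tsum_neg] at h
    linarith
  have h1 := ((summable_weight_cos p u).hasSum.mul_left (Real.cos (u * x))).sub
    (hsin.hasSum.mul_left (Real.sin (u * x)))
  rw [hzero, mul_zero, sub_zero] at h1
  refine hasSum_of_eq h1 (fun z => ?_) ?_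
  · push_cast
    rw [mul_add, Real.cos_add]; ring
  · rw [charExp, sub_sub_cancel]

lemma abs_one_sub_charExp_le (p : PMF ℤ) (u : ℝ) : |1 - charExp p u| ≤ 1 :=
  abs_le.2 ⟨by linarith [charExp_le_two p u], by linarith [charExp_nonneg p u]⟩

lemma integral_cos_mul_int (x : ℤ) :
    ∫ u in (-Real.pi)..Real.pi, Real.cos (u * x) = if x = 0 then 2 * Real.pi else 0 := by
  split_ifs with hx
  · simp [hx]; ring
  · have hx' : (x : ℝ) ≠ 0 := Int.cast_ne_zero.2 hx
    rw [intervalIntegral.integral_comp_mul_right (fun v => Real.cos v) hx', integral_cos,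
      neg_mul, Real.sin_neg, mul_comm, Real.sin_int_mul_pi]
    simp

lemma pow_stepOp_eq_integral {p : PMF ℤ} (hsymm : ∀ x : ℤ, p (-x) = p x) (n : ℕ) (x : ℤ) :
    (stepOp p univ ^ n) (indBdd {0}) x =
      (2 * Real.pi)⁻¹ * ∫ u in (-Real.pi)..Real.pi, Real.cos (u * x) * (1 - charExp p u) ^ n := by
  have hc := continuous_charExp p
  induction n generalizing x with
  | zero =>
    simp only [pow_zero, mul_one, integral_cos_mul_int]
    have : (2 * Real.pi) ≠ 0 := by positivity
    change indBdd {0} x = _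
    by_cases hx : x = 0
    · rw [if_pos hx, inv_mul_cancel₀ this]; simp [indBdd_apply, hx]
    · simp [indBdd_apply, hx]
  | succ n ih =>
    rw [pow_stepOp_succ, stepOp_apply_of_mem p _ (mem_univ x)]
    have h : HasSum (fun z : ℤ => ∫ u in (-Real.pi)..Real.pi,
        weight p z * Real.cos (u * (x + z : ℤ)) * (1 - charExp p u) ^ n)
        (∫ u in (-Real.pi)..Real.pi, Real.cos (u * x) * (1 - charExp p u) ^ (n + 1)) := by
      refine intervalIntegral.hasSum_integral_of_dominated_convergence
        (fun z _ => weight p z) (fun z => Continuous.aestronglyMeasurable (by fun_prop))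
        (fun z => ae_of_all _ fun u _ => ?_)
        (ae_of_all _ fun u _ => (hasSum_weight p).summable) (by simp)
        (ae_of_all _ fun u _ => ?_)
      · rw [Real.norm_eq_abs, abs_mul, abs_mul, abs_pow, abs_of_nonneg (weight_nonneg p z),
          mul_assoc]
        exact mul_le_of_le_one_right (weight_nonneg p z) (mul_le_one₀ (Real.abs_cos_le_one _)
          (by positivity) (pow_le_one₀ (abs_nonneg _) (abs_one_sub_charExp_le p u)))
      · have := (tsum_weight_cos_add hsymm u x).mul_right ((1 - charExp p u) ^ n)
        rwa [mul_assoc, ← pow_succ'] at this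
    rw [← h.tsum_eq, ← tsum_mul_left]
    refine tsum_congr fun z => ?_
    simp only [mul_assoc]
    rw [ih, intervalIntegral.integral_const_mul]
    ring

/-- Fourier inversion for the transition probabilities. -/
lemma semigroup_eq_integral {p : PMF ℤ} (hsymm : ∀ x : ℤ, p (-x) = p x) (t : ℝ) (x : ℤ) :
    semigroup p univ t (indBdd {0}) x = (2 * Real.pi)⁻¹ *
      ∫ u in (-Real.pi)..Real.pi, Real.cos (u * x) * Real.exp (-t * charExp p u) := by
  have hc := continuous_charExp p
  have hexp : ∀ s : ℝ, HasSum (fun n : ℕ => s ^ n / n !) (Real.exp s) := fun s => by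
    rw [Real.exp_eq_exp_ℝ]; exact NormedSpace.expSeries_div_hasSum_exp s
  have h : HasSum (fun n : ℕ => ∫ u in (-Real.pi)..Real.pi,
      Real.exp (-t) * t ^ n / n ! * (Real.cos (u * x) * (1 - charExp p u) ^ n))
      (∫ u in (-Real.pi)..Real.pi, Real.cos (u * x) * Real.exp (-t * charExp p u)) := by
    refine intervalIntegral.hasSum_integral_of_dominated_convergence
      (fun n _ => Real.exp (-t) * (|t| ^ n / n !))
      (fun n => Continuous.aestronglyMeasurable (by fun_prop))
      (fun n => ae_of_all _ fun u _ => ?_)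
      (ae_of_all _ fun u _ => ((hexp |t|).mul_left _).summable) (by simp)
      (ae_of_all _ fun u _ => ?_)
    · rw [Real.norm_eq_abs, abs_mul, abs_div, abs_mul, abs_pow, Real.abs_exp, Nat.abs_cast,
        mul_div_assoc, abs_mul, abs_pow]
      exact mul_le_of_le_one_right (by positivity) (mul_le_one₀ (Real.abs_cos_le_one _)
          (by positivity) (pow_le_one₀ (abs_nonneg _) (abs_one_sub_charExp_le p u)))
    · have h1 := (hexp (t * (1 - charExp p u))).mul_left (Real.exp (-t) * Real.cos (u * x))
      refine hasSum_of_eq h1 (fun n => ?_) ?_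
      · rw [mul_pow]; ring
      · rw [mul_right_comm, ← Real.exp_add, mul_comm]
        congr 2; ring
  refine (hasSum_semigroup p univ t (indBdd {0}) x).unique ?_
  refine hasSum_of_eq (h.mul_left (2 * Real.pi)⁻¹) (fun n => ?_) rfl
  rw [pow_stepOp_eq_integral hsymm, intervalIntegral.integral_const_mul]
  ring

/-! ### The renewal identity -/

/-- `retProb p t x` is the probability that the walk started from `x` is in `0` at time `t`. -/
def retProb (p : PMF ℤ) (t : ℝ) (x : ℤ) : ℝ := semigroup p univ t (indBdd {0}) x

/-- `surv p t x` is the probability that the walk started from `x` avoids `0` until time `t`. -/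
def surv (p : PMF ℤ) (t : ℝ) (x : ℤ) : ℝ := semigroup p {0}ᶜ t (indBdd {0}ᶜ) x

lemma continuous_semigroup_apply (p : PMF ℤ) (g : Set ℤ) (f : BddFun) :
    Continuous fun t => semigroup p g t f :=
  (continuous_semigroup p g).clm_apply continuous_const

lemma continuous_retProb (p : PMF ℤ) (x : ℤ) : Continuous fun t => retProb p t x :=
  (BddFun.eval x).continuous.comp (continuous_semigroup_apply p univ _)

lemma continuous_surv (p : PMF ℤ) (x : ℤ) : Continuous fun t => surv p t x :=
  (BddFun.eval x).continuous.comp (continuous_semigroup_apply p _ _)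

lemma surv_zero_right (p : PMF ℤ) (t : ℝ) : surv p t 0 = 0 := by
  have h := hasSum_semigroup p {0}ᶜ t (indBdd {0}ᶜ) 0
  have h0 : ∀ n : ℕ, (stepOp p {0}ᶜ ^ n) (indBdd {0}ᶜ) 0 = 0 := fun n => by
    cases n with
    | zero => change indBdd {0}ᶜ 0 = 0; simp [indBdd_apply]
    | succ n => rw [pow_stepOp_succ]; exact stepOp_apply_of_notMem p _ (by simp)
  simp only [h0, mul_zero] at h
  exact h.unique hasSum_zero

/-- Markov property plus positivity: the killed semigroup at time `r` is applied to the nonnegative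
function `M 1 - (S(s) - S(s'))` on the complement of `0`. A bound uniform in `y` thereby gains the
factor `surv p r x`. -/
lemma surv_add_sub_le (p : PMF ℤ) {r s s' M : ℝ} (hr : 0 ≤ r)
    (h : ∀ y, surv p s y - surv p s' y ≤ M) (x : ℤ) :
    surv p (r + s) x - surv p (r + s') x ≤ M * surv p r x := by
  set f : BddFun := M • indBdd {0}ᶜ - (semigroup p {0}ᶜ s (indBdd {0}ᶜ) -
    semigroup p {0}ᶜ s' (indBdd {0}ᶜ)) with hf
  have hf0 : ∀ y, 0 ≤ f y := fun y => by
    have h1 : f y = M * indBdd {0}ᶜ y - (surv p s y - surv p s' y) := rfl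
    by_cases hy : y = 0
    · subst hy
      rw [h1, surv_zero_right, surv_zero_right]
      simp [indBdd_apply]
    · have h2 : indBdd {0}ᶜ y = 1 := by simp [indBdd_apply, hy]
      rw [h1, h2]; linarith [h y]
  have h3 := semigroup_nonneg p {0}ᶜ hr hf0 x
  rw [hf, map_sub, map_smul, map_sub] at h3
  have h4 : ∀ s, semigroup p {0}ᶜ r (semigroup p {0}ᶜ s (indBdd {0}ᶜ)) =
      semigroup p {0}ᶜ (r + s) (indBdd {0}ᶜ) := fun s => by rw [semigroup_add]; rfl
  rw [h4, h4] at h3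
  have h5 : 0 ≤ M * surv p r x - (surv p (r + s) x - surv p (r + s') x) := h3
  linarith

/-- The renewal identity, by Duhamel interpolation. With `A r` the truncated potential kernel, the
curve from `A t` to `A 0 = 0` obtained by applying the killed semigroup at `s` to `A (t - s)` has
derivative `-u(t-s) S(s)`. -/
lemma integral_retProb_sub (p : PMF ℤ) (t : ℝ) (x : ℤ) :
    ∫ s in (0 : ℝ)..t, (retProb p s 0 - retProb p s x) =
      ∫ s in (0 : ℝ)..t, retProb p (t - s) 0 * surv p s x := by
  set U : ℝ → BddFun := fun s => semigroup p univ s (indBdd {0}) with hU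
  set H : ℝ → BddFun := fun s => semigroup p {0}ᶜ s (indBdd {0}ᶜ) with hH
  set D : ℝ → BddFun := fun s => retProb p s 0 • indBdd univ - U s with hD
  have hUc : Continuous U := continuous_semigroup_apply p _ _
  have hHc : Continuous H := continuous_semigroup_apply p _ _
  have hDc : Continuous D := ((continuous_retProb p 0).smul continuous_const).sub hUc
  have hDapp : ∀ s y, D s y = retProb p s 0 - retProb p s y := fun s y => by
    have : D s y = retProb p s 0 * indBdd univ y - retProb p s y := rfl
    rw [this]; simp [indBdd_apply]
  set A : ℝ → BddFun := fun r => ∫ s in (0 : ℝ)..r, D s with hA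
  have hAderiv : ∀ r, HasDerivAt A (D r) r := fun r =>
    intervalIntegral.integral_hasDerivAt_right (hDc.intervalIntegrable _ _)
      (hDc.stronglyMeasurableAtFilter _ _) hDc.continuousAt
  have hAapp : ∀ r y, A r y = ∫ s in (0 : ℝ)..r, (retProb p s 0 - retProb p s y) := fun r y => by
    change BddFun.eval y (A r) = _
    rw [hA, ← ContinuousLinearMap.intervalIntegral_comp_comm _ (hDc.intervalIntegrable _ _)]
    exact intervalIntegral.integral_congr fun s _ => hDapp s y
  have hUderiv : ∀ s, HasDerivAt U ((stepOp p univ - 1) (U s)) s := fun s => by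
    have := (hasDerivAt_semigroup' p univ s).clm_apply (hasDerivAt_const s (indBdd {0}))
    simpa using this
  -- `D s` and `-U s` differ by a constant function, which the generator annihilates; integrating
  -- the forward equation for `U` gives the rest.
  have hgen : ∀ r, (stepOp p univ - 1) (A r) = indBdd {0} - U r := fun r => by
    have h1 : ∀ s, (stepOp p univ - 1) (D s) = -((stepOp p univ - 1) (U s)) := fun s => by
      have : (stepOp p univ - 1) (indBdd univ) = 0 := by
        change stepOp p univ (indBdd univ) - indBdd univ = 0
        rw [stepOp_univ_one, sub_self]
      rw [hD, map_sub, map_smul, this, smul_zero, zero_sub]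
    rw [hA, ← ContinuousLinearMap.intervalIntegral_comp_comm _ (hDc.intervalIntegrable _ _)]
    simp only [h1]
    rw [intervalIntegral.integral_neg, intervalIntegral.integral_eq_sub_of_hasDerivAt
      (fun s _ => hUderiv s)
      (((stepOp p univ - 1).continuous.comp hUc).intervalIntegrable _ _), neg_sub]
    congr 1
    simp [hU, semigroup_zero]
  -- Away from `0` the killed and free operators agree and `hgen` applies; at `0` every term
  -- vanishes, since `A r` and `D r` do.
  have hode : ∀ r, (stepOp p {0}ᶜ - 1) (A r) - D r = -(retProb p r 0 • indBdd {0}ᶜ) := fun r => by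
    ext y
    have hL : ((stepOp p {0}ᶜ - 1) (A r) - D r) y =
        stepOp p {0}ᶜ (A r) y - A r y - D r y := rfl
    have hR : (-(retProb p r 0 • indBdd {0}ᶜ)) y = -(retProb p r 0 * indBdd {0}ᶜ y) := rfl
    rw [hL, hR]
    by_cases hy : y = 0
    · subst hy
      rw [stepOp_apply_of_notMem p _ (by simp), hAapp, hDapp]
      simp [indBdd_apply]
    · have h1 : stepOp p univ (A r) y - A r y = indBdd {0} y - U r y := by
        have := congrArg (fun f : BddFun => f y) (hgen r)
        exact this
      rw [stepOp_apply_of_mem p _ (mem_univ y)] at h1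
      rw [stepOp_apply_of_mem p _ (by simpa using hy), h1, hDapp]
      have h2 : U r y = retProb p r y := rfl
      simp [indBdd_apply, hy, h2]
      ring
  have hΦ : ∀ s, HasDerivAt (fun s => semigroup p {0}ᶜ s (A (t - s)))
      (-(retProb p (t - s) 0 • H s)) s := fun s => by
    have h1 := (hAderiv (t - s)).comp_const_sub t s
    have h2 := (hasDerivAt_semigroup p {0}ᶜ s).clm_apply h1
    convert h2 using 1
    have h3 := congrArg (semigroup p {0}ᶜ s) (hode (t - s))
    rw [map_neg, map_smul, map_sub] at h3
    rw [map_neg, ← sub_eq_add_neg]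
    exact h3.symm
  have hcont : Continuous fun s => retProb p (t - s) 0 • H s :=
    ((continuous_retProb p 0).comp (continuous_const.sub continuous_id)).smul hHc
  have hfin := intervalIntegral.integral_eq_sub_of_hasDerivAt (fun s _ => hΦ s)
    (hcont.neg.intervalIntegrable 0 t)
  have hA0 : A 0 = 0 := by simp [hA]
  rw [sub_self, hA0, map_zero, sub_zero, semigroup_zero, intervalIntegral.integral_neg,
    zero_sub, neg_inj] at hfin
  have hfin' := congrArg (BddFun.eval x) hfin
  rw [← ContinuousLinearMap.intervalIntegral_comp_comm _ (hcont.intervalIntegrable 0 t)] at hfin'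
  rw [← hAapp]
  exact hfin'.symm

/-! ### The tail of the jump kernel -/

lemma hasSum_tail (p : PMF ℤ) (x : ℝ) :
    HasSum (fun y : ℤ => weight p y * (if x ≤ |(y : ℝ)| then 1 else 0)) (tail p x) := by
  have h1 : ∀ y : ℤ, ({y : ℤ | x ≤ |(y : ℝ)|}.indicator (fun y => p y) y).toReal =
      weight p y * (if x ≤ |(y : ℝ)| then 1 else 0) := fun y => by
    by_cases hy : x ≤ |(y : ℝ)| <;> simp [indicator, hy, weight]
  have h2 : ∑' y, {y : ℤ | x ≤ |(y : ℝ)|}.indicator (fun y => p y) y ≠ ∞ :=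
    ne_top_of_le_ne_top (by rw [p.tsum_coe]; simp)
      (ENNReal.tsum_le_tsum fun y => indicator_le_self _ _ y)
  have h3 := ENNReal.hasSum_toReal h2
  rw [← ENNReal.tsum_toReal_eq fun y => ne_top_of_le_ne_top (p.apply_ne_top y)
    (indicator_le_self _ _ y)] at h3
  simp only [h1] at h3
  have h4 : tail p x = (∑' y, {y : ℤ | x ≤ |(y : ℝ)|}.indicator (fun y => p y) y).toReal := by
    rw [tail, ← tsum_subtype]; rfl
  exact h4 ▸ h3

lemma tail_nonneg (p : PMF ℤ) (x : ℝ) : 0 ≤ tail p x := ENNReal.toReal_nonneg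

lemma tail_antitone (p : PMF ℤ) : Antitone (tail p) := fun x y hxy =>
  hasSum_le (fun z => by
    refine mul_le_mul_of_nonneg_left ?_ (weight_nonneg p z)
    split_ifs <;> linarith) (hasSum_tail p y) (hasSum_tail p x)

variable {α : ℝ} {p : PMF ℤ}

lemma IsHeavyTailedKernel.tail_pos (hp : IsHeavyTailedKernel α p) (x : ℝ) : 0 < tail p x := by
  obtain ⟨L, -, hT⟩ := hp.tail_asymp
  obtain ⟨y, hxy, hy⟩ := ((eventually_ge_atTop x).and (hT.eventually (lt_mem_nhds one_pos))).exists
  refine lt_of_lt_of_le (lt_of_le_of_ne (tail_nonneg p y) fun h => ?_) (tail_antitone p hxy)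
  rw [← h, zero_div] at hy
  exact lt_irrefl _ hy

lemma IsHeavyTailedKernel.tendsto_tail_ratio (hp : IsHeavyTailedKernel α p) {c : ℝ} (hc : 0 < c) :
    Tendsto (fun x => tail p (c * x) / tail p x) atTop (𝓝 (c ^ (-α))) := by
  obtain ⟨L, ⟨hLpos, hL⟩, hT⟩ := hp.tail_asymp
  have h1 := ((hT.comp (tendsto_id.const_mul_atTop hc)).div hT one_ne_zero).mul
    ((hL c hc).mul_const (c ^ (-α)))
  rw [div_one, one_mul, one_mul] at h1
  refine h1.congr' ?_
  filter_upwards [eventually_gt_atTop 0] with x hx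
  have hT1 := hp.tail_pos x
  have hL1 := hLpos x hx.le
  have hL2 := hLpos (c * x) (by positivity)
  have hx1 : 0 < x ^ α := Real.rpow_pos_of_pos hx α
  have hc1 : 0 < c ^ α := Real.rpow_pos_of_pos hc α
  simp only [Function.comp_apply, id, Pi.div_apply]
  rw [Real.mul_rpow hc.le hx.le, Real.rpow_neg hc.le]
  field_simp

/-- Induction along doublings. -/
lemma dyadic_induction {P : ℝ → Prop} {x₀ : ℝ} (hx₀ : 0 < x₀)
    (h0 : ∀ x, x₀ ≤ x → x ≤ 2 * x₀ → P x) (h : ∀ x, x₀ ≤ x → P x → P (2 * x)) :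
    ∀ x, x₀ ≤ x → P x := by
  have key : ∀ n : ℕ, ∀ x, x₀ ≤ x → x ≤ 2 ^ n * (2 * x₀) → P x := fun n => by
    induction n with
    | zero => intro x h1 h2; exact h0 x h1 (by simpa using h2)
    | succ n ih =>
      intro x h1 h2
      by_cases hx : x ≤ 2 * x₀
      · exact h0 x h1 hx
      · have := h (x / 2) (by linarith) (ih (x / 2) (by linarith) (by rw [pow_succ] at h2; linarith))
        rwa [mul_div_cancel₀ _ two_ne_zero] at this
  intro x hx
  obtain ⟨n, hn⟩ := pow_unbounded_of_one_lt (x / (2 * x₀)) one_lt_two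
  exact key n x hx ((div_lt_iff₀ (by positivity)).1 hn).le

/-- Only jumps with `ε x ≤ |y| < x` are kept: there `1 - cos(y/x)` is at least `2 ε² / π²`. -/
lemma IsHeavyTailedKernel.exists_mul_tail_le_charExp (hp : IsHeavyTailedKernel α p) (hα : 0 < α) :
    ∃ c > 0, ∃ x₀ > 0, ∀ x ≥ x₀, c * tail p x ≤ charExp p (1 / x) := by
  -- This makes `ε^(-α) = 4`, so eventually `tail p (ε * x) ≥ 2 * tail p x` and the jumps kept have
  -- mass at least `tail p x`.
  set ε : ℝ := 4 ^ (-(1 / α)) with hε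
  have hε0 : 0 < ε := by positivity
  have hlim : ε ^ (-α) = 4 := by
    rw [hε, ← Real.rpow_mul (by norm_num)]
    have : -(1 / α) * -α = 1 := by field_simp
    rw [this, Real.rpow_one]
  have h1 := hp.tendsto_tail_ratio hε0
  rw [hlim] at h1
  obtain ⟨x₀, hx₀⟩ := eventually_atTop.1
    ((h1.eventually (lt_mem_nhds (by norm_num : (2 : ℝ) < 4))).and (eventually_gt_atTop 0))
  refine ⟨2 / Real.pi ^ 2 * ε ^ 2, by positivity, max x₀ 1, by positivity, fun x hx => ?_⟩
  obtain ⟨h2, hx0⟩ := hx₀ x ((le_max_left _ _).trans hx)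
  rw [lt_div_iff₀ (hp.tail_pos x)] at h2
  have h3 : 2 / Real.pi ^ 2 * ε ^ 2 * (tail p (ε * x) - tail p x) ≤ charExp p (1 / x) := by
    refine hasSum_le (fun y => ?_) (((hasSum_tail p (ε * x)).sub (hasSum_tail p x)).mul_left
      (2 / Real.pi ^ 2 * ε ^ 2)) (hasSum_charExp p (1 / x))
    rw [← mul_sub, mul_left_comm]
    refine mul_le_mul_of_nonneg_left ?_ (weight_nonneg p y)
    have hcos : 0 ≤ 1 - Real.cos (1 / x * y) := sub_nonneg.2 (Real.cos_le_one _)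
    have hk : 0 ≤ 2 / Real.pi ^ 2 * ε ^ 2 := by positivity
    by_cases hy1 : x ≤ |(y : ℝ)|
    · rw [if_pos hy1]; split_ifs <;> nlinarith
    · rw [if_neg hy1]
      by_cases hy2 : ε * x ≤ |(y : ℝ)|
      · rw [if_pos hy2]
        have habs : |1 / x * (y : ℝ)| = |(y : ℝ)| / x := by
          rw [abs_mul, abs_of_pos (by positivity), one_div_mul_eq_div]
        have hle : |1 / x * (y : ℝ)| ≤ Real.pi := by
          rw [habs]
          exact ((div_lt_one hx0).2 (not_le.1 hy1)).le.trans
            (by linarith [Real.pi_gt_three])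
        have hq := Real.cos_le_one_sub_mul_cos_sq hle
        have hge : ε ≤ |1 / x * (y : ℝ)| := by rw [habs, le_div_iff₀ hx0]; exact hy2
        have hsq : ε ^ 2 ≤ (1 / x * (y : ℝ)) ^ 2 := by
          rw [← sq_abs (1 / x * (y : ℝ))]; gcongr
        have : 2 / Real.pi ^ 2 * ε ^ 2 ≤ 2 / Real.pi ^ 2 * (1 / x * (y : ℝ)) ^ 2 := by gcongr
        linarith
      · rw [if_neg hy2]; simpa using hcos
  refine le_trans ?_ h3
  have hk : 0 ≤ 2 / Real.pi ^ 2 * ε ^ 2 := by positivity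
  exact mul_le_mul_of_nonneg_left (by linarith) hk

lemma IsHeavyTailedKernel.eventually_tail_le (hp : IsHeavyTailedKernel α p) (hα : α ≤ 1)
    {K : ℝ} (hK : 2 < K) : ∃ x₀ > 0, ∀ x ≥ x₀, tail p x ≤ K * tail p (2 * x) := by
  have h1 := hp.tendsto_tail_ratio two_pos
  have h2 : K⁻¹ < (2 : ℝ) ^ (-α) := by
    have : (2 : ℝ) ^ (-1 : ℝ) ≤ 2 ^ (-α) :=
      Real.rpow_le_rpow_of_exponent_le one_le_two (by linarith)
    rw [Real.rpow_neg_one] at this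
    exact (inv_strictAnti₀ two_pos hK).trans_le this
  obtain ⟨x₀, hx₀⟩ := eventually_atTop.1 (h1.eventually (lt_mem_nhds h2))
  refine ⟨max x₀ 1, by positivity, fun x hx => ?_⟩
  have h3 := hx₀ x ((le_max_left _ _).trans hx)
  rw [lt_div_iff₀ (hp.tail_pos x), inv_mul_lt_iff₀ (by linarith)] at h3
  exact h3.le

/-- Since `1 - cos(y/x) ≤ 2 min(x², y²)/x²`, it suffices to bound the truncated second moment `M x`
by `C x² tail p x`. This goes by doubling, where `α ≤ 1` ensures that the tail loses at most a
factor `3 < 4`. -/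
lemma IsHeavyTailedKernel.exists_charExp_le_mul_tail (hp : IsHeavyTailedKernel α p) (hα : α ≤ 1) :
    ∃ C > 0, ∃ x₀ > 0, ∀ x ≥ x₀, charExp p (1 / x) ≤ C * tail p x := by
  obtain ⟨x₀, hx₀, hT⟩ := hp.eventually_tail_le hα (K := 3) (by norm_num)
  have hsum : ∀ x : ℝ, Summable fun y : ℤ => weight p y * min (x ^ 2) ((y : ℝ) ^ 2) := fun x =>
    summable_weight_mul p (M := x ^ 2) fun y => by
      rw [abs_of_nonneg (by positivity)]; exact min_le_left _ _
  set M : ℝ → ℝ := fun x => ∑' y : ℤ, weight p y * min (x ^ 2) ((y : ℝ) ^ 2) with hM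
  have hMsum : ∀ x, HasSum (fun y : ℤ => weight p y * min (x ^ 2) ((y : ℝ) ^ 2)) (M x) :=
    fun x => (hsum x).hasSum
  have hM0 : ∀ x, M x ≤ x ^ 2 := fun x => by
    have h := (hasSum_weight p).mul_right (x ^ 2)
    rw [one_mul] at h
    exact hasSum_le (fun y => mul_le_mul_of_nonneg_left (min_le_left _ _) (weight_nonneg p y))
      (hMsum x) h
  have hM2 : ∀ x, 0 ≤ x → M (2 * x) ≤ M x + 3 * x ^ 2 * tail p x := fun x hx => by
    refine hasSum_le (fun y => ?_) (hMsum (2 * x))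
      ((hMsum x).add ((hasSum_tail p x).mul_left (3 * x ^ 2)))
    rw [mul_left_comm, ← mul_add]
    refine mul_le_mul_of_nonneg_left ?_ (weight_nonneg p y)
    split_ifs with hy
    · have : x ^ 2 ≤ (y : ℝ) ^ 2 := by rw [← sq_abs (y : ℝ)]; gcongr
      rw [min_eq_left this]
      exact (min_le_left _ _).trans (by nlinarith)
    · have : (y : ℝ) ^ 2 ≤ x ^ 2 := by
        rw [← sq_abs (y : ℝ)]; exact pow_le_pow_left₀ (abs_nonneg _) (not_le.1 hy).le 2
      rw [min_eq_right this, mul_zero, add_zero]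
      exact min_le_right _ _
  have hpos := hp.tail_pos (2 * x₀)
  -- The value `9` closes the doubling step, `3 (C + 3) ≤ 4 C`; the other entry covers the initial
  -- range through `M x ≤ x²`.
  set C : ℝ := max 9 (tail p (2 * x₀))⁻¹ with hC
  have hC9 : 9 ≤ C := le_max_left _ _
  have hmain : ∀ x ≥ x₀, M x ≤ C * x ^ 2 * tail p x := by
    refine dyadic_induction hx₀ (fun x h1 h2 => ?_) fun x h1 h2 => ?_
    · have h3 : 1 ≤ C * tail p x := by
        have := mul_le_mul (le_max_right 9 (tail p (2 * x₀))⁻¹) (tail_antitone p h2) hpos.le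
          (by positivity)
        rwa [inv_mul_cancel₀ hpos.ne'] at this
      nlinarith [hM0 x, sq_nonneg x]
    · have hx : 0 ≤ x := by linarith
      have h3 := hM2 x hx
      have h4 := hT x h1
      have h5 : (C + 3) * x ^ 2 * tail p x ≤ (C + 3) * x ^ 2 * (3 * tail p (2 * x)) := by gcongr
      have h6 : 0 ≤ x ^ 2 * tail p (2 * x) := mul_nonneg (sq_nonneg x) (tail_nonneg p _)
      nlinarith
  refine ⟨2 * C, by positivity, x₀, hx₀, fun x hx => ?_⟩
  have hx0 : 0 < x := hx₀.trans_le hx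
  have h1 : charExp p (1 / x) ≤ 2 / x ^ 2 * M x := by
    refine hasSum_le (fun y => ?_) (hasSum_charExp p (1 / x)) ((hMsum x).mul_left (2 / x ^ 2))
    rw [mul_left_comm]
    refine mul_le_mul_of_nonneg_left ?_ (weight_nonneg p y)
    rcases min_choice (x ^ 2) ((y : ℝ) ^ 2) with h | h
    · rw [h, div_mul_cancel₀ _ (by positivity)]
      linarith [Real.neg_one_le_cos (1 / x * y)]
    · rw [h]
      have := Real.one_sub_sq_div_two_le_cos (x := 1 / x * y)
      have h2 : (1 / x * (y : ℝ)) ^ 2 = 1 / x ^ 2 * (y : ℝ) ^ 2 := by ring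
      have h3 : 2 / x ^ 2 * (y : ℝ) ^ 2 = 2 * (1 / x ^ 2 * (y : ℝ) ^ 2) := by ring
      have h4 : 0 ≤ 1 / x ^ 2 * (y : ℝ) ^ 2 := by positivity
      rw [h2] at this
      linarith
  refine h1.trans ((mul_le_mul_of_nonneg_left (hmain x hx) (by positivity)).trans_eq ?_)
  field_simp

/-- The exponent only has to exceed `1 ≥ α`, to beat the slowly varying factor, and stay below
`4/3`, so that its product with `3/2` is less than `2` in the Fourier bound below. -/
lemma IsHeavyTailedKernel.exists_rpow_le_tail (hp : IsHeavyTailedKernel α p) (hα : α ≤ 1) :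
    ∃ c > 0, ∃ x₀ > 0, ∀ x ≥ x₀, c * x ^ (-(5 / 4) : ℝ) ≤ tail p x := by
  have hK : (2 : ℝ) < 2 ^ (5 / 4 : ℝ) := by
    have := Real.rpow_lt_rpow_of_exponent_lt one_lt_two (by norm_num : (1 : ℝ) < 5 / 4)
    rwa [Real.rpow_one] at this
  obtain ⟨x₀, hx₀, hT⟩ := hp.eventually_tail_le hα hK
  have hpos := hp.tail_pos (2 * x₀)
  refine ⟨tail p (2 * x₀) * x₀ ^ (5 / 4 : ℝ), by positivity, x₀, hx₀, ?_⟩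
  refine dyadic_induction hx₀ (fun x h1 h2 => ?_) fun x h1 h2 => ?_
  · have h3 : x ^ (-(5 / 4) : ℝ) ≤ x₀ ^ (-(5 / 4) : ℝ) :=
      Real.rpow_le_rpow_of_nonpos hx₀ h1 (by norm_num)
    have h4 : x₀ ^ (5 / 4 : ℝ) * x₀ ^ (-(5 / 4) : ℝ) = 1 := by
      rw [← Real.rpow_add hx₀]; norm_num
    calc tail p (2 * x₀) * x₀ ^ (5 / 4 : ℝ) * x ^ (-(5 / 4) : ℝ)
        ≤ tail p (2 * x₀) * x₀ ^ (5 / 4 : ℝ) * x₀ ^ (-(5 / 4) : ℝ) := by gcongr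
      _ = tail p (2 * x₀) := by rw [mul_assoc, h4, mul_one]
      _ ≤ tail p x := tail_antitone p h2
  · have h3 := h2.trans (hT x h1)
    rw [Real.mul_rpow two_pos.le (hx₀.le.trans h1), Real.rpow_neg two_pos.le]
    rw [← inv_mul_le_iff₀ (by positivity)] at h3
    linarith

/-! ### The characteristic exponent near zero and away from zero -/

lemma charExp_two_mul_le (p : PMF ℤ) (u : ℝ) : charExp p (2 * u) ≤ 4 * charExp p u := by
  refine hasSum_le (fun y => ?_) (hasSum_charExp p (2 * u)) ((hasSum_charExp p u).mul_left 4)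
  rw [mul_left_comm]
  refine mul_le_mul_of_nonneg_left ?_ (weight_nonneg p y)
  rw [mul_assoc, Real.cos_two_mul]
  nlinarith [sq_nonneg (1 - Real.cos (u * y))]

lemma charExp_abs (p : PMF ℤ) (u : ℝ) : charExp p |u| = charExp p u := by
  rcases abs_choice u with h | h <;> rw [h]
  exact charExp_neg p u

/-- If the exponent vanishes at `v`, then `cos(v y) = 1` on the support. The integers `y` with `v y`
a multiple of `2π` form a subgroup, so by aperiodicity `1` is among them, and `|v| ≤ π` forces `v =
0`. -/
lemma IsHeavyTailedKernel.charExp_pos (hp : IsHeavyTailedKernel α p) {v : ℝ} (hv0 : v ≠ 0)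
    (hv : |v| ≤ Real.pi) : 0 < charExp p v := by
  refine lt_of_le_of_ne (charExp_nonneg p v) fun h => hv0 ?_
  have hsum := hasSum_charExp p v
  rw [← h] at hsum
  have hnn : ∀ y : ℤ, 0 ≤ weight p y * (1 - Real.cos (v * y)) := fun y =>
    mul_nonneg (weight_nonneg p y) (sub_nonneg.2 (Real.cos_le_one _))
  have hz := (hasSum_zero_iff_of_nonneg hnn).1 hsum
  let S : AddSubgroup ℤ :=
    { carrier := {y | ∃ n : ℤ, (n : ℝ) * (2 * Real.pi) = v * y}
      zero_mem' := ⟨0, by simp⟩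
      add_mem' := by
        rintro a b ⟨m, hm⟩ ⟨n, hn⟩
        exact ⟨m + n, by push_cast; rw [add_mul, hm, hn]; ring⟩
      neg_mem' := by
        rintro a ⟨m, hm⟩
        exact ⟨-m, by push_cast; rw [neg_mul, hm]; ring⟩ }
  have hle : AddSubgroup.closure {x : ℤ | p x ≠ 0} ≤ S := by
    rw [AddSubgroup.closure_le]
    intro y hy
    have h1 : weight p y ≠ 0 := ENNReal.toReal_ne_zero.2 ⟨hy, p.apply_ne_top y⟩
    have h2 : Real.cos (v * y) = 1 := by
      have := (mul_eq_zero.1 (congrFun hz y)).resolve_left h1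
      linarith
    exact (Real.cos_eq_one_iff _).1 h2
  rw [hp.aperiodic] at hle
  obtain ⟨n, hn⟩ : ∃ n : ℤ, (n : ℝ) * (2 * Real.pi) = v * (1 : ℤ) := hle (AddSubgroup.mem_top 1)
  rw [Int.cast_one, mul_one] at hn
  have hπ := Real.pi_pos
  have habs : |(n : ℝ)| < 1 := by
    by_contra! hcon
    have : |v| = |(n : ℝ)| * (2 * Real.pi) := by
      rw [← hn, abs_mul, abs_of_pos (show (0 : ℝ) < 2 * Real.pi by positivity)]
    nlinarith
  have hn0 : n = 0 := by
    rw [← Int.cast_abs, ← Int.cast_one, Int.cast_lt] at habs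
    exact Int.abs_lt_one_iff.1 habs
  rw [← hn, hn0]; simp

lemma IsHeavyTailedKernel.exists_le_charExp (hp : IsHeavyTailedKernel α p) {δ : ℝ} (hδ : 0 < δ) :
    ∃ m > 0, ∀ v, δ ≤ |v| → |v| ≤ Real.pi → m ≤ charExp p v := by
  by_cases hne : δ ≤ Real.pi
  · obtain ⟨v₀, hv₀, hmin⟩ := isCompact_Icc.exists_isMinOn (nonempty_Icc.2 hne)
      (continuous_charExp p).continuousOn
    refine ⟨charExp p v₀, hp.charExp_pos (by linarith [hv₀.1]) ?_, fun v h1 h2 => ?_⟩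
    · rw [abs_of_pos (by linarith [hv₀.1])]; exact hv₀.2
    · rw [← charExp_abs p v]; exact hmin ⟨h1, h2⟩
  · exact ⟨1, one_pos, fun v h1 h2 => absurd (h1.trans h2) hne⟩

/-- Near zero, the characteristic exponent is comparable to the tail. -/
lemma IsHeavyTailedKernel.exists_charExp_bounds (hp : IsHeavyTailedKernel α p) (hα0 : 0 < α)
    (hα1 : α ≤ 1) : ∃ c > 0, ∃ C > 0, ∃ x₀ > 0, ∀ x ≥ x₀,
      c * tail p x ≤ charExp p (1 / x) ∧ charExp p (1 / x) ≤ C * tail p x := by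
  obtain ⟨c, hc, x₁, hx₁, h1⟩ := hp.exists_mul_tail_le_charExp hα0
  obtain ⟨C, hC, x₂, hx₂, h2⟩ := hp.exists_charExp_le_mul_tail hα1
  exact ⟨c, hc, C, hC, max x₁ x₂, by positivity, fun x hx =>
    ⟨h1 x ((le_max_left _ _).trans hx), h2 x ((le_max_right _ _).trans hx)⟩⟩

lemma forall_abs_le_of_one_div {P : ℝ → Prop} {x₀ : ℝ} (hx₀ : 0 < x₀) (h0 : P 0)
    (habs : ∀ v, P |v| → P v) (h : ∀ x, x₀ ≤ x → P (1 / x)) : ∀ v, |v| ≤ 1 / x₀ → P v := by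
  intro v hv
  rcases eq_or_ne v 0 with rfl | hv0
  · exact h0
  · have hpos : 0 < |v| := abs_pos.2 hv0
    refine habs v ?_
    have := h (1 / |v|) (by rw [le_div_iff₀ hpos]; rw [le_div_iff₀ hx₀] at hv; linarith)
    rwa [one_div_one_div] at this

/-- The limiting tail ratio `k^(-α)` tends to `0`, so a large `k` outweighs the loss `C/c` in
comparing exponent and tail. -/
lemma IsHeavyTailedKernel.exists_charExp_div_le_half (hp : IsHeavyTailedKernel α p) (hα0 : 0 < α)
    (hα1 : α ≤ 1) : ∃ k ≥ (1 : ℝ), ∃ δ > 0, ∀ v, |v| ≤ δ →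
      charExp p (v / k) ≤ charExp p v / 2 := by
  obtain ⟨c, hc, C, hC, x₀, hx₀, hb⟩ := hp.exists_charExp_bounds hα0 hα1
  obtain ⟨k, hk, hk1⟩ := (((tendsto_rpow_neg_atTop hα0).eventually
    (gt_mem_nhds (by positivity : 0 < c / (4 * C)))).and (eventually_ge_atTop 1)).exists
  have hk0 : 0 < k := by linarith
  have hlim := hp.tendsto_tail_ratio hk0
  obtain ⟨x₁, hx₁⟩ := eventually_atTop.1 (hlim.eventually (gt_mem_nhds
    (by linarith [show (0 : ℝ) < c / (4 * C) by positivity] : k ^ (-α) < c / (4 * C) * 2)))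
  refine ⟨k, hk1, 1 / max x₀ x₁, by positivity, forall_abs_le_of_one_div (by positivity)
    (by simp [charExp_zero]) (fun v h => ?_) fun x hx => ?_⟩
  · rw [charExp_abs, ← charExp_abs p (|v| / k), abs_div, abs_abs, ← abs_div, charExp_abs] at h
    exact h
  · have hx0 : x₀ ≤ x := (le_max_left _ _).trans hx
    have hxpos : 0 < x := hx₀.trans_le hx0
    have h1 := hx₁ x ((le_max_right _ _).trans hx)
    rw [div_lt_iff₀ (hp.tail_pos x)] at h1
    have h2 := (hb (k * x) (by nlinarith)).2
    have h3 := (hb x hx0).1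
    have h4 : 1 / x / k = 1 / (k * x) := by field_simp
    rw [h4]
    have h5 : C * (c / (4 * C) * 2 * tail p x) = c * tail p x / 2 := by field_simp; ring
    nlinarith

/-- Here `K` is of order `k^α`, so `α < 1` leaves room for `4 K < k`. This inequality later makes
the tail integral of the return probability contract. -/
lemma IsHeavyTailedKernel.exists_charExp_le_mul_charExp_div (hp : IsHeavyTailedKernel α p)
    (hα0 : 0 < α) (hα1 : α < 1) : ∃ k ≥ (1 : ℝ), ∃ K ≥ 1, 4 * K < k ∧ ∃ δ > 0, ∀ v, |v| ≤ δ →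
      charExp p v ≤ K * charExp p (v / k) := by
  obtain ⟨c, hc, C, hC, x₀, hx₀, hb⟩ := hp.exists_charExp_bounds hα0 hα1.le
  -- The first condition gives `4 K < k` when `K = 2 C / c * k ^ α`, the second when the maximum
  -- defining `K` is `1`.
  obtain ⟨k, hk, hk1⟩ := (((tendsto_rpow_atTop (sub_pos.2 hα1)).eventually_gt_atTop
    (8 * C / c)).and (eventually_ge_atTop 5)).exists
  have hk0 : 0 < k := by linarith
  have hkα : 0 < k ^ α := Real.rpow_pos_of_pos hk0 α
  have hlim := hp.tendsto_tail_ratio hk0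
  have hkα' : 0 < k ^ (-α) := Real.rpow_pos_of_pos hk0 _
  obtain ⟨x₁, hx₁⟩ := eventually_atTop.1 (hlim.eventually (lt_mem_nhds
    (half_lt_self hkα')))
  refine ⟨k, by linarith, max (2 * C / c * k ^ α) 1, le_max_right _ _, ?_, 1 / max x₀ x₁,
    by positivity,
    forall_abs_le_of_one_div (by positivity) (by simp [charExp_zero]) (fun v h => ?_)
    fun x hx => ?_⟩
  · have h1 : k ^ (1 - α) * k ^ α = k := by
      rw [← Real.rpow_add hk0]; simp
    rw [mul_max_of_nonneg _ _ (by norm_num)]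
    refine max_lt ?_ (by linarith)
    calc 4 * (2 * C / c * k ^ α) = 8 * C / c * k ^ α := by ring
      _ < k ^ (1 - α) * k ^ α := by gcongr
      _ = k := h1
  · rw [charExp_abs, ← charExp_abs p (|v| / k), abs_div, abs_abs, ← abs_div, charExp_abs] at h
    exact h
  · have hx0 : x₀ ≤ x := (le_max_left _ _).trans hx
    have hxpos : 0 < x := hx₀.trans_le hx0
    have h1 := hx₁ x ((le_max_right _ _).trans hx)
    rw [lt_div_iff₀ (hp.tail_pos x), Real.rpow_neg hk0.le] at h1
    have h2 := (hb (k * x) (by nlinarith)).1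
    have h3 := (hb x hx0).2
    have h4 : 1 / x / k = 1 / (k * x) := by field_simp
    rw [h4]
    calc charExp p (1 / x) ≤ C * tail p x := h3
      _ = 2 * C / c * k ^ α * (c * ((k ^ α)⁻¹ / 2 * tail p x)) := by field_simp
      _ ≤ 2 * C / c * k ^ α * charExp p (1 / (k * x)) := by
        gcongr
        exact (mul_le_mul_of_nonneg_left h1.le hc.le).trans h2
      _ ≤ max (2 * C / c * k ^ α) 1 * charExp p (1 / (k * x)) :=
        mul_le_mul_of_nonneg_right (le_max_left _ _) (charExp_nonneg p _)

lemma IsHeavyTailedKernel.exists_rpow_le_charExp (hp : IsHeavyTailedKernel α p) (hα0 : 0 < α)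
    (hα1 : α ≤ 1) : ∃ c > 0, ∀ u, |u| ≤ Real.pi → c * |u| ^ (5 / 4 : ℝ) ≤ charExp p u := by
  obtain ⟨c₁, hc₁, x₁, hx₁, h1⟩ := hp.exists_mul_tail_le_charExp hα0
  obtain ⟨c₂, hc₂, x₂, hx₂, h2⟩ := hp.exists_rpow_le_tail hα1
  have hx : 0 < max x₁ x₂ := by positivity
  have hnear : ∀ v, |v| ≤ 1 / max x₁ x₂ → c₁ * c₂ * |v| ^ (5 / 4 : ℝ) ≤ charExp p v := by
    refine forall_abs_le_of_one_div hx (by simp [charExp_zero])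
      (fun v h => by rwa [abs_abs, charExp_abs] at h) fun x hx' => ?_
    have hxpos : 0 < x := hx.trans_le hx'
    have h3 := h1 x ((le_max_left _ _).trans hx')
    have h4 := h2 x ((le_max_right _ _).trans hx')
    rw [abs_of_pos (by positivity), one_div, Real.inv_rpow hxpos.le, ← Real.rpow_neg hxpos.le,
      mul_assoc, ← one_div]
    exact (mul_le_mul_of_nonneg_left h4 hc₁.le).trans h3
  obtain ⟨m, hm, hfar⟩ := hp.exists_le_charExp (δ := 1 / max x₁ x₂) (by positivity)
  have hπ : 0 < Real.pi ^ (5 / 4 : ℝ) := Real.rpow_pos_of_pos Real.pi_pos _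
  refine ⟨min (c₁ * c₂) (m / Real.pi ^ (5 / 4 : ℝ)), by positivity, fun u hu => ?_⟩
  rcases le_total |u| (1 / max x₁ x₂) with h | h
  · exact (mul_le_mul_of_nonneg_right (min_le_left _ _) (by positivity)).trans (hnear u h)
  · refine (mul_le_mul (min_le_right _ _)
      (Real.rpow_le_rpow (abs_nonneg u) hu (by norm_num)) (by positivity) (by positivity)).trans ?_
    rw [div_mul_cancel₀ _ hπ.ne']
    exact hfar u h hu

/-! ### The return probability -/

lemma retProb_zero_eq (hsymm : ∀ x : ℤ, p (-x) = p x) (t : ℝ) :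
    2 * Real.pi * retProb p t 0 =
      ∫ u in (-Real.pi)..Real.pi, Real.exp (-t * charExp p u) := by
  have h : (2 * Real.pi) ≠ 0 := by positivity
  rw [retProb, semigroup_eq_integral hsymm, mul_inv_cancel_left₀ h]
  simp

lemma continuous_exp_charExp (p : PMF ℤ) (t : ℝ) :
    Continuous fun u => Real.exp (-t * charExp p u) := by
  have := continuous_charExp p
  fun_prop

lemma retProb_nonneg (p : PMF ℤ) {t : ℝ} (ht : 0 ≤ t) (x : ℤ) : 0 ≤ retProb p t x :=
  semigroup_nonneg p univ ht (indBdd_nonneg _) x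

lemma retProb_antitone (hsymm : ∀ x : ℤ, p (-x) = p x) : Antitone fun t => retProb p t 0 := by
  intro s t hst
  have h : (0 : ℝ) < 2 * Real.pi := by positivity
  refine le_of_mul_le_mul_left ?_ h
  simp only [retProb_zero_eq hsymm]
  refine intervalIntegral.integral_mono_on (by linarith [Real.pi_pos])
    ((continuous_exp_charExp p t).intervalIntegrable _ _)
    ((continuous_exp_charExp p s).intervalIntegrable _ _) fun u _ => ?_
  exact Real.exp_le_exp.2 (by nlinarith [charExp_nonneg p u])

lemma retProb_zero_zero (p : PMF ℤ) : retProb p 0 0 = 1 := by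
  rw [retProb, semigroup_zero]
  change indBdd {0} 0 = 1
  simp [indBdd_apply]

lemma integral_exp_charExp_le (hsymm : ∀ x : ℤ, p (-x) = p x) {δ : ℝ} (hδ : 0 ≤ δ)
    (hδπ : δ ≤ Real.pi) (t : ℝ) :
    ∫ u in (-δ)..δ, Real.exp (-t * charExp p u) ≤ 2 * Real.pi * retProb p t 0 := by
  rw [retProb_zero_eq hsymm]
  exact intervalIntegral.integral_mono_interval (by linarith) (by linarith) hδπ
    (ae_of_all _ fun u => (Real.exp_pos _).le)
    ((continuous_exp_charExp p t).intervalIntegrable _ _)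

lemma retProb_le_integral_add (hsymm : ∀ x : ℤ, p (-x) = p x) {δ m : ℝ} (hδ : 0 < δ)
    (hδπ : δ ≤ Real.pi) (hm : ∀ v, δ ≤ |v| → |v| ≤ Real.pi → m ≤ charExp p v) {t : ℝ}
    (ht : 0 ≤ t) :
    2 * Real.pi * retProb p t 0 ≤ (∫ u in (-δ)..δ, Real.exp (-t * charExp p u)) +
      2 * Real.pi * Real.exp (-t * m) := by
  have hi := fun a b => (continuous_exp_charExp p t).intervalIntegrable (μ := volume) a b
  have hpt : ∀ v, δ ≤ |v| → |v| ≤ Real.pi →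
      Real.exp (-t * charExp p v) ≤ Real.exp (-t * m) := fun v h1 h2 =>
    Real.exp_le_exp.2 (by nlinarith [hm v h1 h2])
  have h1 : ∫ u in (-Real.pi)..(-δ), Real.exp (-t * charExp p u) ≤
      (Real.pi - δ) * Real.exp (-t * m) := by
    have := intervalIntegral.integral_mono_on (by linarith) (hi (-Real.pi) (-δ))
      (intervalIntegrable_const (c := Real.exp (-t * m))) fun v hv => by
        have h0 : v ≤ 0 := by linarith [hv.2]
        exact hpt v (by rw [abs_of_nonpos h0]; linarith [hv.2])
          (by rw [abs_of_nonpos h0]; linarith [hv.1])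
    rw [intervalIntegral.integral_const, smul_eq_mul] at this
    linarith
  have h2 : ∫ u in δ..Real.pi, Real.exp (-t * charExp p u) ≤
      (Real.pi - δ) * Real.exp (-t * m) := by
    have := intervalIntegral.integral_mono_on hδπ (hi δ Real.pi)
      (intervalIntegrable_const (c := Real.exp (-t * m))) fun v hv => by
        have h0 : 0 ≤ v := by linarith [hv.1]
        exact hpt v (by rw [abs_of_nonneg h0]; exact hv.1)
          (by rw [abs_of_nonneg h0]; exact hv.2)
    rw [intervalIntegral.integral_const, smul_eq_mul] at this
    linarith
  rw [retProb_zero_eq hsymm, ← intervalIntegral.integral_add_adjacent_intervals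
    (hi (-Real.pi) (-δ)) (hi (-δ) Real.pi),
    ← intervalIntegral.integral_add_adjacent_intervals (hi (-δ) δ) (hi δ Real.pi)]
  nlinarith [Real.exp_pos (-t * m)]

/-- The return probability decays slower than any exponential. -/
lemma exists_exp_le_retProb (hsymm : ∀ x : ℤ, p (-x) = p x) {η : ℝ} (hη : 0 < η) :
    ∃ c > 0, ∀ t, 0 ≤ t → c * Real.exp (-t * η) ≤ retProb p t 0 := by
  have hcont := (continuous_charExp p).tendsto 0
  rw [charExp_zero] at hcont
  obtain ⟨δ', hδ', hball⟩ := Metric.eventually_nhds_iff.1 (hcont.eventually (gt_mem_nhds hη))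
  set δ := min (δ' / 2) Real.pi with hδdef
  have hδ : 0 < δ := lt_min (by positivity) Real.pi_pos
  refine ⟨δ / Real.pi, by positivity, fun t ht => ?_⟩
  have h1 := integral_exp_charExp_le hsymm hδ.le (min_le_right _ _) t
  have h2 : (δ - -δ) * Real.exp (-t * η) ≤ ∫ u in (-δ)..δ, Real.exp (-t * charExp p u) := by
    rw [← smul_eq_mul, ← intervalIntegral.integral_const]
    refine intervalIntegral.integral_mono_on (by linarith) intervalIntegrable_const
      ((continuous_exp_charExp p t).intervalIntegrable _ _) fun u hu => ?_
    have h3 : |u| < δ' := by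
      have := abs_le.2 hu
      have := min_le_left (δ' / 2) Real.pi
      linarith
    have := hball (y := u) (by simpa using h3)
    exact Real.exp_le_exp.2 (by nlinarith)
  rw [div_mul_eq_mul_div, div_le_iff₀ Real.pi_pos]
  linarith

lemma retProb_pos (hsymm : ∀ x : ℤ, p (-x) = p x) {t : ℝ} (ht : 0 ≤ t) : 0 < retProb p t 0 := by
  obtain ⟨c, hc, h⟩ := exists_exp_le_retProb hsymm one_pos
  exact lt_of_lt_of_le (by positivity) (h t ht)

/-- Near zero frequency, substituting `u / k` trades time `t` for `2 t` at the cost of a factor `k`.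
The other frequencies contribute an exponentially small term, which the return probability
dominates. -/
lemma IsHeavyTailedKernel.retProb_doubling (hp : IsHeavyTailedKernel α p) (hα0 : 0 < α)
    (hα1 : α ≤ 1) : ∃ C > 0, ∀ t, 0 ≤ t → retProb p t 0 ≤ C * retProb p (2 * t) 0 := by
  obtain ⟨k, hk, δ', hδ', hψ⟩ := hp.exists_charExp_div_le_half hα0 hα1
  set δ := min δ' Real.pi with hδdef
  have hδ : 0 < δ := lt_min hδ' Real.pi_pos
  have hδπ : δ ≤ Real.pi := min_le_right _ _
  have hk0 : 0 < k := by linarith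
  obtain ⟨m, hm, hfar⟩ := hp.exists_le_charExp hδ
  -- Rate `m / 2` at time `2 t` matches the remainder `exp (-t * m)`.
  obtain ⟨c, hc, hlow⟩ := exists_exp_le_retProb hp.symm (half_pos hm)
  refine ⟨k + 1 / c, by positivity, fun t ht => ?_⟩
  have h1 := retProb_le_integral_add hp.symm hδ hδπ hfar ht
  have h2 : ∫ u in (-δ)..δ, Real.exp (-t * charExp p u) ≤
      ∫ u in (-δ)..δ, Real.exp (-(2 * t) * charExp p (u / k)) := by
    refine intervalIntegral.integral_mono_on (by linarith)
      ((continuous_exp_charExp p t).intervalIntegrable _ _)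
      (((continuous_exp_charExp p (2 * t)).comp
        (continuous_id.div_const k)).intervalIntegrable _ _) fun u hu => ?_
    have := hψ u ((abs_le.2 hu).trans (min_le_left _ _))
    exact Real.exp_le_exp.2 (by nlinarith)
  have h3 : ∫ u in (-δ)..δ, Real.exp (-(2 * t) * charExp p (u / k)) ≤
      k * (2 * Real.pi * retProb p (2 * t) 0) := by
    rw [intervalIntegral.integral_comp_div (fun v => Real.exp (-(2 * t) * charExp p v)) hk0.ne',
      smul_eq_mul, neg_div]
    refine mul_le_mul_of_nonneg_left (integral_exp_charExp_le hp.symm (by positivity) ?_ _) hk0.le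
    exact (div_le_self hδ.le hk).trans hδπ
  have h4 : Real.exp (-t * m) ≤ 1 / c * retProb p (2 * t) 0 := by
    have := hlow (2 * t) (by linarith)
    rw [one_div, ← div_eq_inv_mul, le_div_iff₀ hc, mul_comm]
    rwa [show -t * m = -(2 * t) * (m / 2) by ring]
  have hπ := Real.pi_pos
  have h5 : 2 * Real.pi * retProb p t 0 ≤
      2 * Real.pi * ((k + 1 / c) * retProb p (2 * t) 0) := by
    have := mul_le_mul_of_nonneg_left h4 (by positivity : 0 ≤ 2 * Real.pi)
    linarith
  exact le_of_mul_le_mul_left h5 (by positivity)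

/-- The reverse rescaling: shrinking frequencies by `k` trades time `K s` for `s` and gains `1/k`. A
second `1/k` pays for the frequencies away from zero. -/
lemma IsHeavyTailedKernel.retProb_decay (hp : IsHeavyTailedKernel α p) {k K δ' : ℝ} (hk : 1 ≤ k)
    (hK : 0 < K) (hδ' : 0 < δ') (hψ : ∀ v, |v| ≤ δ' → charExp p v ≤ K * charExp p (v / k)) :
    ∃ s₀ > 0, ∀ s ≥ s₀, retProb p (K * s) 0 ≤ 2 / k * retProb p s 0 := by
  set δ := min δ' Real.pi with hδdef
  have hδ : 0 < δ := lt_min hδ' Real.pi_pos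
  have hδπ : δ ≤ Real.pi := min_le_right _ _
  have hk0 : 0 < k := by linarith
  obtain ⟨m, hm, hfar⟩ := hp.exists_le_charExp (δ := δ / k) (by positivity)
  -- Half of the rate `K m` is compared with the return probability; the other half makes the
  -- prefactor smaller than `c / k`.
  obtain ⟨c, hc, hlow⟩ := exists_exp_le_retProb hp.symm (η := K * m / 2) (by positivity)
  have hlim : Tendsto (fun s : ℝ => Real.exp (-(s * (K * m / 2)))) atTop (𝓝 0) :=
    Real.tendsto_exp_neg_atTop_nhds_zero.comp
      (tendsto_id.atTop_mul_const (by positivity))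
  obtain ⟨s₁, hs₁⟩ := eventually_atTop.1 (hlim.eventually (gt_mem_nhds
    (by positivity : 0 < c / k)))
  refine ⟨max s₁ 1, by positivity, fun s hs => ?_⟩
  have hs0 : 0 < s := lt_of_lt_of_le (by positivity) hs
  have h1 := retProb_le_integral_add hp.symm (by positivity : 0 < δ / k)
    ((div_le_self hδ.le hk).trans hδπ) hfar (t := K * s) (by positivity)
  have h2 : ∫ u in (-(δ / k))..(δ / k), Real.exp (-(K * s) * charExp p u) ≤
      1 / k * (2 * Real.pi * retProb p s 0) := by
    have h3 := intervalIntegral.integral_comp_div (a := -δ) (b := δ)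
      (fun v => Real.exp (-(K * s) * charExp p v)) hk0.ne'
    rw [smul_eq_mul, neg_div] at h3
    rw [one_div, ← div_eq_inv_mul, le_div_iff₀ hk0, mul_comm, ← h3]
    refine le_trans ?_ (integral_exp_charExp_le hp.symm hδ.le hδπ s)
    refine intervalIntegral.integral_mono_on (by linarith)
      (((continuous_exp_charExp p (K * s)).comp
        (continuous_id.div_const k)).intervalIntegrable _ _)
      ((continuous_exp_charExp p s).intervalIntegrable _ _) fun u hu => ?_
    have := hψ u ((abs_le.2 hu).trans (min_le_left _ _))
    exact Real.exp_le_exp.2 (by nlinarith)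
  have h4 : Real.exp (-(K * s) * m) ≤ 1 / k * retProb p s 0 := by
    have h5 := hlow s hs0.le
    have h6 := hs₁ s ((le_max_left _ _).trans hs)
    have h7 : Real.exp (-(K * s) * m) =
        Real.exp (-(s * (K * m / 2))) * Real.exp (-s * (K * m / 2)) := by
      rw [← Real.exp_add]; congr 1; ring
    rw [h7]
    calc Real.exp (-(s * (K * m / 2))) * Real.exp (-s * (K * m / 2))
        ≤ c / k * Real.exp (-s * (K * m / 2)) := by gcongr
      _ = 1 / k * (c * Real.exp (-s * (K * m / 2))) := by ring
      _ ≤ 1 / k * retProb p s 0 := by gcongr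
  have hπ := Real.pi_pos
  have h5 : 2 * Real.pi * retProb p (K * s) 0 ≤ 2 * Real.pi * (2 / k * retProb p s 0) := by
    have := mul_le_mul_of_nonneg_left h4 (by positivity : 0 ≤ 2 * Real.pi)
    have h6 : 2 / k = 1 / k + 1 / k := by ring
    rw [h6]
    linarith
  exact le_of_mul_le_mul_left h5 (by positivity)

lemma charExp_le_sixteen_mul (p : PMF ℤ) (v : ℝ) : charExp p v ≤ 16 * charExp p (v / 4) := by
  have h1 := charExp_two_mul_le p (v / 2)
  have h2 := charExp_two_mul_le p (v / 4)
  rw [show 2 * (v / 2) = v by ring] at h1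
  rw [show 2 * (v / 4) = v / 2 by ring] at h2
  linarith

lemma retProb_sub_eq (hsymm : ∀ x : ℤ, p (-x) = p x) (t : ℝ) (x : ℤ) :
    2 * Real.pi * (retProb p t 0 - retProb p t x) =
      ∫ u in (-Real.pi)..Real.pi, (1 - Real.cos (u * x)) * Real.exp (-t * charExp p u) := by
  have h : (2 * Real.pi) ≠ 0 := by positivity
  have hc := continuous_charExp p
  have h1 : 2 * Real.pi * retProb p t x =
      ∫ u in (-Real.pi)..Real.pi, Real.cos (u * x) * Real.exp (-t * charExp p u) := by
    rw [retProb, semigroup_eq_integral hsymm, mul_inv_cancel_left₀ h]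
  rw [mul_sub, retProb_zero_eq hsymm, h1, ← intervalIntegral.integral_sub
    (Continuous.intervalIntegrable (by fun_prop) _ _)
    (Continuous.intervalIntegrable (by fun_prop) _ _)]
  exact intervalIntegral.integral_congr fun u _ => by ring

lemma retProb_le_zero (hsymm : ∀ x : ℤ, p (-x) = p x) (t : ℝ) (x : ℤ) :
    retProb p t x ≤ retProb p t 0 := by
  have h := retProb_sub_eq hsymm t x
  have h1 : 0 ≤ ∫ u in (-Real.pi)..Real.pi,
      (1 - Real.cos (u * x)) * Real.exp (-t * charExp p u) :=
    intervalIntegral.integral_nonneg (by linarith [Real.pi_pos]) fun u _ =>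
      mul_nonneg (sub_nonneg.2 (Real.cos_le_one _)) (Real.exp_pos _).le
  rw [← h] at h1
  have := (mul_nonneg_iff_of_pos_left (by positivity : (0 : ℝ) < 2 * Real.pi)).1 h1
  linarith

/-- The power `3/2` exceeds `1`, for integrability in time, while `1 - (3/2)(5/4) = -7/8` is still
integrable in frequency at `0`. -/
lemma exp_neg_le_rpow {y : ℝ} (hy : 0 < y) : Real.exp (-y) ≤ 2 * y ^ (-(3 / 2) : ℝ) := by
  have h1 : y ^ (3 / 2 : ℝ) ≤ 1 + y ^ 2 := by
    rcases le_total y 1 with h | h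
    · exact (Real.rpow_le_one hy.le h (by norm_num)).trans (by nlinarith)
    · have := Real.rpow_le_rpow_of_exponent_le h (by norm_num : (3 / 2 : ℝ) ≤ 2)
      rw [Real.rpow_two] at this
      linarith
  have h2 := Real.quadratic_le_exp_of_nonneg hy.le
  have h3 : y ^ (3 / 2 : ℝ) ≤ 2 * Real.exp y := by nlinarith
  rw [Real.rpow_neg hy.le, Real.exp_neg, ← div_eq_mul_inv, inv_eq_one_div,
    div_le_div_iff₀ (Real.exp_pos y) (Real.rpow_pos_of_pos hy _), one_mul]
  exact h3

lemma IsHeavyTailedKernel.exists_retProb_sub_le (hp : IsHeavyTailedKernel α p) (hα0 : 0 < α)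
    (hα1 : α ≤ 1) : ∃ C > 0, ∀ t > 0, ∀ x : ℤ,
      retProb p t 0 - retProb p t x ≤ C * |(x : ℝ)| * t ^ (-(3 / 2) : ℝ) := by
  obtain ⟨c, hc, hψ⟩ := hp.exists_rpow_le_charExp hα0 hα1
  have hint : IntervalIntegrable (fun u : ℝ => u ^ (-(7 / 8) : ℝ)) volume 0 Real.pi :=
    intervalIntegral.intervalIntegrable_rpow' (by norm_num)
  set J : ℝ := ∫ u in (0 : ℝ)..Real.pi, u ^ (-(7 / 8) : ℝ) with hJ
  have hπ := Real.pi_pos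
  have hJ0 : 0 ≤ J := intervalIntegral.integral_nonneg hπ.le fun u hu => Real.rpow_nonneg hu.1 _
  refine ⟨(2 * Real.pi)⁻¹ * (4 * c ^ (-(3 / 2) : ℝ) * J) + 1, by positivity, fun t ht x => ?_⟩
  set F : ℝ → ℝ := fun u => (1 - Real.cos (u * x)) * Real.exp (-t * charExp p u) with hF
  have hc' := continuous_charExp p
  have hFc : Continuous F := by fun_prop
  have heven : ∀ u, F (-u) = F u := fun u => by simp [hF, charExp_neg]
  have h1 : ∫ u in (-Real.pi)..0, F u = ∫ u in (0 : ℝ)..Real.pi, F u := by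
    have := intervalIntegral.integral_comp_neg (a := 0) (b := Real.pi) F
    rw [neg_zero] at this
    rw [← this]
    simp only [heven]
  have h2 : ∫ u in (0 : ℝ)..Real.pi, F u ≤
      ∫ u in (0 : ℝ)..Real.pi, 2 * |(x : ℝ)| * c ^ (-(3 / 2) : ℝ) * t ^ (-(3 / 2) : ℝ) *
        u ^ (-(7 / 8) : ℝ) := by
    refine intervalIntegral.integral_mono_on hπ.le (hFc.intervalIntegrable _ _)
      (hint.const_mul _) fun u hu => ?_
    rcases hu.1.eq_or_lt with h0 | h0
    · rw [← h0]; simp [hF]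
    · have h3 := hψ u (by rw [abs_of_pos h0]; exact hu.2)
      rw [abs_of_pos h0] at h3
      have h4 : Real.exp (-t * charExp p u) ≤ Real.exp (-(t * (c * u ^ (5 / 4 : ℝ)))) :=
        Real.exp_le_exp.2 (by nlinarith)
      have hu54 : 0 < u ^ (5 / 4 : ℝ) := Real.rpow_pos_of_pos h0 _
      have h5 := h4.trans (exp_neg_le_rpow (by positivity))
      have h6 : 1 - Real.cos (u * x) ≤ u * |(x : ℝ)| := by
        have h7 := Real.one_sub_sq_div_two_le_cos (x := u * x)
        have h8 := Real.neg_one_le_cos (u * x)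
        have h9 : (u * (x : ℝ)) ^ 2 = (u * |(x : ℝ)|) ^ 2 := by rw [mul_pow, mul_pow, sq_abs]
        rw [h9] at h7
        have h10 : 0 ≤ u * |(x : ℝ)| := by positivity
        rcases le_total (u * |(x : ℝ)|) 2 with h | h
        · nlinarith
        · linarith
      have h7 : u * (u ^ (5 / 4 : ℝ)) ^ (-(3 / 2) : ℝ) = u ^ (-(7 / 8) : ℝ) := by
        nth_rewrite 1 [← Real.rpow_one u]
        rw [← Real.rpow_mul h0.le, ← Real.rpow_add h0]
        norm_num
      calc F u ≤ u * |(x : ℝ)| * (2 * (t * (c * u ^ (5 / 4 : ℝ))) ^ (-(3 / 2) : ℝ)) :=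
            mul_le_mul h6 h5 (Real.exp_pos _).le (by positivity)
        _ = 2 * |(x : ℝ)| * c ^ (-(3 / 2) : ℝ) * t ^ (-(3 / 2) : ℝ) *
            (u * (u ^ (5 / 4 : ℝ)) ^ (-(3 / 2) : ℝ)) := by
          rw [Real.mul_rpow ht.le (by positivity), Real.mul_rpow hc.le hu54.le]; ring
        _ = _ := by rw [h7]
  rw [intervalIntegral.integral_const_mul, ← hJ] at h2
  have h3 := retProb_sub_eq hp.symm t x
  rw [← intervalIntegral.integral_add_adjacent_intervals
    (hFc.intervalIntegrable (-Real.pi) 0) (hFc.intervalIntegrable 0 Real.pi), h1] at h3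
  have h4 : retProb p t 0 - retProb p t x =
      (2 * Real.pi)⁻¹ * ((∫ u in (0 : ℝ)..Real.pi, F u) + ∫ u in (0 : ℝ)..Real.pi, F u) := by
    rw [← h3, inv_mul_cancel_left₀ (by positivity)]
  have h5 : 0 ≤ |(x : ℝ)| * t ^ (-(3 / 2) : ℝ) := by positivity
  rw [h4]
  have h6 := mul_le_mul_of_nonneg_left (add_le_add h2 h2)
    (by positivity : 0 ≤ (2 * Real.pi)⁻¹)
  calc _ ≤ _ := h6
    _ = (2 * Real.pi)⁻¹ * (4 * c ^ (-(3 / 2) : ℝ) * J) * (|(x : ℝ)| * t ^ (-(3 / 2) : ℝ)) := by ring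
    _ ≤ _ := by
      rw [add_mul, one_mul, add_mul]
      nlinarith [abs_nonneg (x : ℝ)]

/-! ### The Green function -/

/-- The expected time spent in `0` until time `t`, for the walk started from `0`. -/
def retGreen (p : PMF ℤ) (t : ℝ) : ℝ := ∫ s in (0 : ℝ)..t, retProb p s 0

lemma intervalIntegrable_retProb (p : PMF ℤ) (x : ℤ) (a b : ℝ) :
    IntervalIntegrable (fun s => retProb p s x) volume a b :=
  (continuous_retProb p x).intervalIntegrable a b

lemma hasDerivAt_retGreen (p : PMF ℤ) (t : ℝ) :
    HasDerivAt (retGreen p) (retProb p t 0) t :=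
  intervalIntegral.integral_hasDerivAt_right (intervalIntegrable_retProb p 0 _ _)
    ((continuous_retProb p 0).stronglyMeasurableAtFilter _ _) (continuous_retProb p 0).continuousAt

lemma continuous_retGreen (p : PMF ℤ) : Continuous (retGreen p) :=
  continuous_iff_continuousAt.2 fun t => (hasDerivAt_retGreen p t).continuousAt

lemma retGreen_sub (p : PMF ℤ) (a b : ℝ) :
    retGreen p b - retGreen p a = ∫ s in a..b, retProb p s 0 :=
  intervalIntegral.integral_interval_sub_left (intervalIntegrable_retProb p 0 _ _)
    (intervalIntegrable_retProb p 0 _ _)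

lemma retGreen_zero (p : PMF ℤ) : retGreen p 0 = 0 := intervalIntegral.integral_same

lemma integral_retProb_le (hsymm : ∀ x : ℤ, p (-x) = p x) {a b : ℝ} (hab : a ≤ b) :
    ∫ s in a..b, retProb p s 0 ≤ (b - a) * retProb p a 0 := by
  rw [← smul_eq_mul, ← intervalIntegral.integral_const]
  exact intervalIntegral.integral_mono_on hab (intervalIntegrable_retProb p 0 _ _)
    intervalIntegrable_const fun s hs => retProb_antitone hsymm hs.1

lemma le_integral_retProb (hsymm : ∀ x : ℤ, p (-x) = p x) {a b : ℝ} (hab : a ≤ b) :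
    (b - a) * retProb p b 0 ≤ ∫ s in a..b, retProb p s 0 := by
  rw [← smul_eq_mul, ← intervalIntegral.integral_const]
  exact intervalIntegral.integral_mono_on hab intervalIntegrable_const
    (intervalIntegrable_retProb p 0 _ _) fun s hs => retProb_antitone hsymm hs.2

lemma retGreen_mono (p : PMF ℤ) {a b : ℝ} (ha : 0 ≤ a) (hab : a ≤ b) :
    retGreen p a ≤ retGreen p b := by
  have h := retGreen_sub p a b
  have : 0 ≤ ∫ s in a..b, retProb p s 0 :=
    intervalIntegral.integral_nonneg hab fun s hs => retProb_nonneg p (ha.trans hs.1) 0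
  linarith

lemma mul_retProb_le_retGreen (hsymm : ∀ x : ℤ, p (-x) = p x) {t : ℝ} (ht : 0 ≤ t) :
    t * retProb p t 0 ≤ retGreen p t := by
  simpa [retGreen] using le_integral_retProb hsymm ht

lemma retGreen_le (hsymm : ∀ x : ℤ, p (-x) = p x) {t : ℝ} (ht : 0 ≤ t) : retGreen p t ≤ t := by
  simpa [retGreen, retProb_zero_zero] using integral_retProb_le hsymm ht

lemma retGreen_pos (hsymm : ∀ x : ℤ, p (-x) = p x) {t : ℝ} (ht : 0 < t) : 0 < retGreen p t :=
  (mul_pos ht (retProb_pos hsymm ht.le)).trans_le (mul_retProb_le_retGreen hsymm ht.le)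

lemma retGreen_two_mul_le (hsymm : ∀ x : ℤ, p (-x) = p x) {t : ℝ} (ht : 0 ≤ t) :
    retGreen p (2 * t) ≤ 2 * retGreen p t := by
  have h := retGreen_sub p t (2 * t)
  have h1 := integral_retProb_le hsymm (by linarith : t ≤ 2 * t)
  have h2 := mul_retProb_le_retGreen hsymm ht
  have h3 : (2 * t - t) * retProb p t 0 = t * retProb p t 0 := by ring
  linarith

/-- Decay with `k = 4`, `K = 16` gives `u(t/16) ≥ 2 u(t)`. Hence `G(t) ≥ (t/16) 2 u(t) + (15/16) t
u(t) = (17/16) t u(t)`; the gap over the trivial bound `t u(t) ≤ G(t)` is what matters. -/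
lemma IsHeavyTailedKernel.eventually_mul_retProb_le (hp : IsHeavyTailedKernel α p) :
    ∃ t₀ > 0, ∀ t ≥ t₀, 17 * (t * retProb p t 0) ≤ 16 * retGreen p t := by
  obtain ⟨s₀, hs₀, h⟩ := hp.retProb_decay (k := 4) (K := 16) (δ' := 1) (by norm_num) (by norm_num)
    one_pos fun v _ => charExp_le_sixteen_mul p v
  refine ⟨16 * s₀, by positivity, fun t ht => ?_⟩
  have hs : s₀ ≤ t / 16 := by linarith
  have h1 := h (t / 16) hs
  rw [mul_div_cancel₀ _ (by norm_num)] at h1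
  have h2 := mul_retProb_le_retGreen hp.symm (hs₀.le.trans hs)
  have h3 := retGreen_sub p (t / 16) t
  have h4 := le_integral_retProb hp.symm (by linarith : t / 16 ≤ t)
  have h5 : t / 16 * (2 * retProb p t 0) ≤ t / 16 * retProb p (t / 16) 0 :=
    mul_le_mul_of_nonneg_left (by linarith) (by linarith)
  nlinarith

/-- The derivative of `s / G(s)` is `(G - s u)/G²`, which the preceding gap bounds below by `1/(17
G)`. -/
lemma IsHeavyTailedKernel.integral_inv_retGreen_le (hp : IsHeavyTailedKernel α p) :
    ∃ t₀ > 0, ∀ t ≥ t₀, ∫ s in t₀..t, (retGreen p s)⁻¹ ≤ 17 * (t / retGreen p t) := by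
  obtain ⟨t₀, ht₀, h⟩ := hp.eventually_mul_retProb_le
  refine ⟨t₀, ht₀, fun t ht => ?_⟩
  have hpos : ∀ s ∈ Icc t₀ t, 0 < retGreen p s := fun s hs =>
    retGreen_pos hp.symm (ht₀.trans_le hs.1)
  have hderiv : ∀ s ∈ uIcc t₀ t, HasDerivAt (fun s => s / retGreen p s)
      ((1 * retGreen p s - s * retProb p s 0) / retGreen p s ^ 2) s := fun s hs => by
    rw [uIcc_of_le ht] at hs
    exact (hasDerivAt_id s).div (hasDerivAt_retGreen p s) (hpos s hs).ne'
  have hcont : ContinuousOn (fun s => (1 * retGreen p s - s * retProb p s 0) / retGreen p s ^ 2)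
      (uIcc t₀ t) := by
    rw [uIcc_of_le ht]
    refine ContinuousOn.div (Continuous.continuousOn ?_)
      ((continuous_retGreen p).pow 2).continuousOn fun s hs => (pow_pos (hpos s hs) 2).ne'
    exact (continuous_const.mul (continuous_retGreen p)).sub
      (continuous_id.mul (continuous_retProb p 0))
  have h1 := intervalIntegral.integral_eq_sub_of_hasDerivAt hderiv hcont.intervalIntegrable
  have h2 : ∫ s in t₀..t, (retGreen p s)⁻¹ ≤
      ∫ s in t₀..t, 17 * ((1 * retGreen p s - s * retProb p s 0) / retGreen p s ^ 2) := by
    refine intervalIntegral.integral_mono_on ht (ContinuousOn.intervalIntegrable ?_)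
      (hcont.intervalIntegrable.const_mul 17) fun s hs => ?_
    · rw [uIcc_of_le ht]
      exact (continuous_retGreen p).continuousOn.inv₀ fun s hs => (hpos s hs).ne'
    · have h3 := h s hs.1
      have h4 := hpos s hs
      rw [← mul_div_assoc, le_div_iff₀ (by positivity), pow_two, inv_mul_cancel_left₀ h4.ne']
      linarith
  rw [intervalIntegral.integral_const_mul, h1] at h2
  have h3 : 0 ≤ t₀ / retGreen p t₀ := (div_pos ht₀ (hpos t₀ ⟨le_rfl, ht⟩)).le
  linarith

/-- Rescaling time by `K` and using the decay `2/k` bounds the integral over `[K t, K T]` by half of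
the integral over `[t, T]`. What remains is the integral over `[t, K t]`, at most `(K - 1) t u(t)`.
-/
lemma IsHeavyTailedKernel.exists_integral_retProb_le (hp : IsHeavyTailedKernel α p) (hα0 : 0 < α)
    (hα1 : α < 1) : ∃ C > 0, ∃ t₀ > 0, ∀ t ≥ t₀, ∀ T ≥ t,
      ∫ s in t..T, retProb p s 0 ≤ C * (t * retProb p t 0) := by
  obtain ⟨k, hk, K, hK, hKk, δ, hδ, hψ⟩ := hp.exists_charExp_le_mul_charExp_div hα0 hα1
  obtain ⟨s₀, hs₀, h⟩ := hp.retProb_decay hk (by linarith) hδ hψ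
  have hK0 : 0 < K := by linarith
  refine ⟨2 * K, by positivity, s₀, hs₀, fun t ht T hT => ?_⟩
  have ht0 : 0 < t := hs₀.trans_le ht
  have hT0 : 0 < T := ht0.trans_le hT
  set I := ∫ s in t..T, retProb p s 0 with hI
  have hI0 : 0 ≤ I := intervalIntegral.integral_nonneg hT fun s hs =>
    retProb_nonneg p (ht0.le.trans hs.1) 0
  have h1 : ∫ s in (K * t)..(K * T), retProb p s 0 ≤ 1 / 2 * I := by
    have h2 := intervalIntegral.integral_comp_mul_left (a := t) (b := T)
      (fun s => retProb p s 0) hK0.ne'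
    rw [smul_eq_mul, ← div_eq_inv_mul, eq_div_iff hK0.ne', mul_comm] at h2
    rw [← h2]
    have h3 : ∫ s in t..T, retProb p (K * s) 0 ≤ ∫ s in t..T, 2 / k * retProb p s 0 := by
      refine intervalIntegral.integral_mono_on hT
        (((continuous_retProb p 0).comp (continuous_const.mul continuous_id)).intervalIntegrable
          _ _) ((intervalIntegrable_retProb p 0 _ _).const_mul _) fun s hs => ?_
      exact h s (ht.trans hs.1)
    rw [intervalIntegral.integral_const_mul, ← hI] at h3
    calc _ ≤ K * (2 / k * I) := mul_le_mul_of_nonneg_left h3 hK0.le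
      _ = 2 * K / k * I := by ring
      _ ≤ 1 / 2 * I := by
        refine mul_le_mul_of_nonneg_right ?_ hI0
        rw [div_le_iff₀ (by linarith)]; linarith
  have h2 : I ≤ (∫ s in t..(K * t), retProb p s 0) + ∫ s in (K * t)..(K * T), retProb p s 0 := by
    rw [intervalIntegral.integral_add_adjacent_intervals (intervalIntegrable_retProb p 0 _ _)
      (intervalIntegrable_retProb p 0 _ _), hI, ← retGreen_sub, ← retGreen_sub]
    have := retGreen_mono p hT0.le (by nlinarith : T ≤ K * T)
    linarith
  have h3 := integral_retProb_le hp.symm (by nlinarith : t ≤ K * t)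
  have h4 := retProb_nonneg p ht0.le 0
  have h5 : 0 ≤ t * retProb p t 0 := by positivity
  nlinarith

/-! ### Survival probabilities -/

lemma surv_eq_hitTail (p : PMF ℤ) {x : ℤ} (hx : x ≠ 0) {t : ℝ} (ht : 0 ≤ t) :
    surv p t x = hitTail p x t := (hitTail_eq_semigroup p hx ht).symm

lemma surv_nonneg (p : PMF ℤ) {t : ℝ} (ht : 0 ≤ t) (x : ℤ) : 0 ≤ surv p t x :=
  semigroup_nonneg p _ ht (indBdd_nonneg _) x

lemma surv_le_one (p : PMF ℤ) {t : ℝ} (ht : 0 ≤ t) (x : ℤ) : surv p t x ≤ 1 := by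
  rcases eq_or_ne x 0 with rfl | hx
  · rw [surv_zero_right]; exact zero_le_one
  · rw [surv_eq_hitTail p hx ht]; exact measureReal_le_one

lemma surv_antitone (p : PMF ℤ) {s t : ℝ} (hs : 0 ≤ s) (hst : s ≤ t) (x : ℤ) :
    surv p t x ≤ surv p s x := by
  rcases eq_or_ne x 0 with rfl | hx
  · rw [surv_zero_right, surv_zero_right]
  · rw [surv_eq_hitTail p hx hs, surv_eq_hitTail p hx (hs.trans hst)]
    exact measureReal_mono fun ω hω => (EReal.coe_le_coe_iff.2 hst).trans_lt hω

lemma exp_neg_le_surv (p : PMF ℤ) {x : ℤ} (hx : x ≠ 0) {t : ℝ} (ht : 0 ≤ t) :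
    Real.exp (-t) ≤ surv p t x := by
  have h := hasSum_semigroup p {0}ᶜ t (indBdd {0}ᶜ) x
  have h1 := le_hasSum h 0 fun n _ =>
    mul_nonneg (by positivity) (pow_stepOp_nonneg p _ (indBdd_nonneg _) n x)
  have h2 : (stepOp p {0}ᶜ ^ 0) (indBdd {0}ᶜ) x = 1 := by
    change indBdd {0}ᶜ x = 1
    simp [indBdd_apply, hx]
  rw [h2] at h1
  simpa [surv] using h1

lemma continuous_retProb_mul_surv (p : PMF ℤ) (t : ℝ) (x : ℤ) :
    Continuous fun s => retProb p (t - s) 0 * surv p s x :=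
  ((continuous_retProb p 0).comp (continuous_const.sub continuous_id)).mul (continuous_surv p x)

lemma integral_retProb_sub_left (p : PMF ℤ) (a b t : ℝ) :
    ∫ s in a..b, retProb p (t - s) 0 = retGreen p (t - a) - retGreen p (t - b) := by
  rw [intervalIntegral.integral_comp_sub_left (fun s => retProb p s 0), retGreen_sub]

/-! ### The potential kernel -/

/-- The potential kernel up to time `t`. -/
def potUpTo (p : PMF ℤ) (x : ℤ) (t : ℝ) : ℝ :=
  ∫ s in (0 : ℝ)..t, (retProb p s 0 - retProb p s x)

lemma potKernelUpTo_eq (p : PMF ℤ) (x : ℤ) {t : ℝ} (ht : 0 ≤ t) :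
    potKernelUpTo p x t = potUpTo p x t := by
  refine intervalIntegral.integral_congr fun s hs => ?_
  rw [uIcc_of_le ht] at hs
  simp only [retProb, transProb_eq_semigroup p _ hs.1]

lemma green_eq (p : PMF ℤ) {t : ℝ} (ht : 0 ≤ t) : green p 0 t = retGreen p t := by
  refine intervalIntegral.integral_congr fun s hs => ?_
  rw [uIcc_of_le ht] at hs
  simp only [retProb, transProb_eq_semigroup p _ hs.1]

lemma potUpTo_eq_retGreen_sub (p : PMF ℤ) (x : ℤ) (t : ℝ) :
    potUpTo p x t = retGreen p t - ∫ s in (0 : ℝ)..t, retProb p s x :=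
  intervalIntegral.integral_sub (intervalIntegrable_retProb p 0 _ _)
    (intervalIntegrable_retProb p x _ _)

lemma continuous_retProb_sub (p : PMF ℤ) (x : ℤ) :
    Continuous fun s => retProb p s 0 - retProb p s x :=
  (continuous_retProb p 0).sub (continuous_retProb p x)

lemma potUpTo_sub (p : PMF ℤ) (x : ℤ) (s t : ℝ) :
    potUpTo p x t - potUpTo p x s = ∫ r in s..t, (retProb p r 0 - retProb p r x) :=
  intervalIntegral.integral_interval_sub_left
    ((continuous_retProb_sub p x).intervalIntegrable _ _)
    ((continuous_retProb_sub p x).intervalIntegrable _ _)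

lemma potUpTo_mono (hsymm : ∀ x : ℤ, p (-x) = p x) (x : ℤ) : Monotone (potUpTo p x) := by
  intro s t hst
  have h := potUpTo_sub p x s t
  have : 0 ≤ ∫ r in s..t, (retProb p r 0 - retProb p r x) :=
    intervalIntegral.integral_nonneg hst fun r _ => sub_nonneg.2 (retProb_le_zero hsymm r x)
  linarith

lemma IsHeavyTailedKernel.exists_potUpTo_sub_le (hp : IsHeavyTailedKernel α p) (hα0 : 0 < α)
    (hα1 : α ≤ 1) : ∃ C > 0, ∀ x : ℤ, ∀ t > 0, ∀ T ≥ t,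
      potUpTo p x T - potUpTo p x t ≤ C * (|(x : ℝ)| / t ^ (1 / 2 : ℝ)) := by
  obtain ⟨C, hC, h⟩ := hp.exists_retProb_sub_le hα0 hα1
  refine ⟨2 * C, by positivity, fun x t ht T hT => ?_⟩
  have hni : (0 : ℝ) ∉ uIcc t T := by
    rw [uIcc_of_le hT]; exact fun h => absurd h.1 (not_le.2 ht)
  have h1 : ∫ r in t..T, (retProb p r 0 - retProb p r x) ≤
      ∫ r in t..T, C * |(x : ℝ)| * r ^ (-(3 / 2) : ℝ) :=
    intervalIntegral.integral_mono_on hT ((continuous_retProb_sub p x).intervalIntegrable _ _)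
      ((intervalIntegral.intervalIntegrable_rpow (Or.inr hni)).const_mul _)
      fun r hr => h r (ht.trans_le hr.1) x
  rw [intervalIntegral.integral_const_mul, integral_rpow (Or.inr ⟨by norm_num, hni⟩)] at h1
  have h2 : (-(3 / 2) + 1 : ℝ) = -(1 / 2) := by norm_num
  rw [h2, Real.rpow_neg ht.le] at h1
  have h3 : 0 ≤ T ^ (-(1 / 2) : ℝ) := Real.rpow_nonneg (ht.le.trans hT) _
  rw [potUpTo_sub]
  refine h1.trans ?_
  have h4 : 0 ≤ C * |(x : ℝ)| := by positivity
  have h5 : 2 * C * (|(x : ℝ)| / t ^ (1 / 2 : ℝ)) =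
      C * |(x : ℝ)| * (2 * (t ^ (1 / 2 : ℝ))⁻¹) := by ring
  rw [h5]
  refine mul_le_mul_of_nonneg_left ?_ h4
  rw [div_le_iff_of_neg (by norm_num)]
  linarith

lemma IsHeavyTailedKernel.tendsto_potUpTo (hp : IsHeavyTailedKernel α p) (hα0 : 0 < α)
    (hα1 : α ≤ 1) (x : ℤ) : Tendsto (potUpTo p x) atTop (𝓝 (potKernel p x)) := by
  obtain ⟨C, hC, h⟩ := hp.exists_potUpTo_sub_le hα0 hα1
  have hbdd : BddAbove (range (potUpTo p x)) := by
    refine ⟨potUpTo p x 1 + C * (|(x : ℝ)| / 1 ^ (1 / 2 : ℝ)), ?_⟩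
    rintro _ ⟨t, rfl⟩
    have h1 := potUpTo_mono hp.symm x (le_max_left t 1)
    have h2 := h x 1 one_pos (max t 1) (le_max_right t 1)
    linarith
  have hlim := tendsto_atTop_ciSup (potUpTo_mono hp.symm x) hbdd
  have hlim' : Tendsto (potKernelUpTo p x) atTop (𝓝 (⨆ t, potUpTo p x t)) :=
    hlim.congr' ((eventually_ge_atTop 0).mono fun t ht => (potKernelUpTo_eq p x ht).symm)
  rwa [potKernel, hlim'.limUnder_eq]

lemma IsHeavyTailedKernel.potUpTo_le (hp : IsHeavyTailedKernel α p) (hα0 : 0 < α)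
    (hα1 : α ≤ 1) (x : ℤ) (t : ℝ) : potUpTo p x t ≤ potKernel p x :=
  (potUpTo_mono hp.symm x).ge_of_tendsto (hp.tendsto_potUpTo hα0 hα1 x) t

lemma IsHeavyTailedKernel.potKernel_sub_le (hp : IsHeavyTailedKernel α p) (hα0 : 0 < α)
    (hα1 : α ≤ 1) {x : ℤ} {t M : ℝ} (h : ∀ T ≥ t, potUpTo p x T - potUpTo p x t ≤ M) :
    potKernel p x - potUpTo p x t ≤ M :=
  le_of_tendsto ((hp.tendsto_potUpTo hα0 hα1 x).sub_const _) ((eventually_ge_atTop t).mono h)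

/-! ### Bounds for the survival probability -/

lemma retGreen_mul_surv_le (p : PMF ℤ) {t : ℝ} (ht : 0 ≤ t) (x : ℤ) :
    retGreen p t * surv p t x ≤ potUpTo p x t := by
  have h := integral_retProb_sub_left p 0 t t
  rw [sub_zero, sub_self, retGreen_zero, sub_zero] at h
  rw [← h, ← intervalIntegral.integral_mul_const, potUpTo, integral_retProb_sub]
  refine intervalIntegral.integral_mono_on ht (Continuous.intervalIntegrable ?_ _ _)
    ((continuous_retProb_mul_surv p t x).intervalIntegrable _ _) fun s hs => ?_
  · exact ((continuous_retProb p 0).comp (continuous_const.sub continuous_id)).mul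
      continuous_const
  · exact mul_le_mul_of_nonneg_left (surv_antitone p hs.1 hs.2 x)
      (retProb_nonneg p (sub_nonneg.2 hs.2) 0)

lemma IsHeavyTailedKernel.surv_le_div (hp : IsHeavyTailedKernel α p) (hα0 : 0 < α)
    (hα1 : α ≤ 1) {t : ℝ} (ht : 0 < t) (x : ℤ) :
    surv p t x ≤ potKernel p x / retGreen p t := by
  rw [le_div_iff₀ (retGreen_pos hp.symm ht), mul_comm]
  exact (retGreen_mul_surv_le p ht.le x).trans (hp.potUpTo_le hα0 hα1 x t)

/-- A walk that makes no jump up to time `1` survives. The uniform lower bound lets constants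
independent of `x` be absorbed into `a(x)`. -/
lemma IsHeavyTailedKernel.exists_le_potKernel (hp : IsHeavyTailedKernel α p) (hα0 : 0 < α)
    (hα1 : α ≤ 1) : ∃ c > 0, ∀ x : ℤ, x ≠ 0 → c ≤ potKernel p x := by
  have hG := retGreen_pos hp.symm one_pos
  refine ⟨retGreen p 1 * Real.exp (-1), by positivity, fun x hx => ?_⟩
  exact (mul_le_mul_of_nonneg_left (exp_neg_le_surv p hx zero_le_one) hG.le).trans
    ((retGreen_mul_surv_le p zero_le_one x).trans (hp.potUpTo_le hα0 hα1 x 1))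

lemma integral_retProb_eq (p : PMF ℤ) (y : ℤ) (t : ℝ) :
    ∫ s in (0 : ℝ)..t, retProb p s y =
      ∫ v in (0 : ℝ)..t, retProb p v 0 * (1 - surv p (t - v) y) := by
  have h1 := potUpTo_eq_retGreen_sub p y t
  rw [potUpTo, integral_retProb_sub] at h1
  have h2 := intervalIntegral.integral_comp_sub_left (a := 0) (b := t)
    (fun v => retProb p v 0 * surv p (t - v) y) t
  simp only [sub_sub_cancel, sub_zero, sub_self] at h2
  rw [h2] at h1
  simp only [mul_sub, mul_one]
  rw [intervalIntegral.integral_sub (intervalIntegrable_retProb p 0 _ _)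
    (Continuous.intervalIntegrable ?_ _ _), h1, retGreen]
  · ring
  · exact (continuous_retProb p 0).mul
      ((continuous_surv p y).comp (continuous_const.sub continuous_id))

/-- The time spent at `0` during `[s, 2t]` is largest, in mean, for the start `0`. For the start `y`
it is written by first passage as a difference of integrals of `u(v)` against hitting probabilities.
By monotonicity the net weight of `u(v)` is at least `S(s,y) - S(t,y)` for `v ≤ t`, and nonnegative
beyond. -/
lemma surv_sub_mul_retGreen_le (hsymm : ∀ x : ℤ, p (-x) = p x) {s t : ℝ} (hs : 0 ≤ s)
    (hst : s ≤ t) (y : ℤ) :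
    (surv p s y - surv p t y) * retGreen p t ≤ ∫ r in s..(2 * t), retProb p r 0 := by
  have ht : 0 ≤ t := hs.trans hst
  have hc : ∀ r, Continuous fun v => retProb p v 0 * (1 - surv p (r - v) y) := fun r =>
    (continuous_retProb p 0).mul (continuous_const.sub
      ((continuous_surv p y).comp (continuous_const.sub continuous_id)))
  have hI := fun r a b => (hc r).intervalIntegrable (μ := volume) a b
  have h1 : ∫ r in s..(2 * t), retProb p r y ≤ ∫ r in s..(2 * t), retProb p r 0 :=
    intervalIntegral.integral_mono_on (by linarith) (intervalIntegrable_retProb p y _ _)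
      (intervalIntegrable_retProb p 0 _ _) fun r _ => retProb_le_zero hsymm r y
  refine le_trans ?_ h1
  rw [← intervalIntegral.integral_interval_sub_left (intervalIntegrable_retProb p y 0 (2 * t))
    (intervalIntegrable_retProb p y 0 s), integral_retProb_eq, integral_retProb_eq,
    ← intervalIntegral.integral_add_adjacent_intervals (hI (2 * t) 0 t) (hI (2 * t) t (2 * t)),
    ← intervalIntegral.integral_add_adjacent_intervals (hI (2 * t) 0 s) (hI (2 * t) s t)]
  have h2 : 0 ≤ ∫ v in t..(2 * t), retProb p v 0 * (1 - surv p (2 * t - v) y) :=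
    intervalIntegral.integral_nonneg (by linarith) fun v hv =>
      mul_nonneg (retProb_nonneg p (ht.trans hv.1) 0)
        (sub_nonneg.2 (surv_le_one p (sub_nonneg.2 hv.2) y))
  have h3 : ∫ v in s..t, retProb p v 0 * (surv p s y - surv p t y) ≤
      ∫ v in s..t, retProb p v 0 * (1 - surv p (2 * t - v) y) := by
    refine intervalIntegral.integral_mono_on hst
      ((intervalIntegrable_retProb p 0 _ _).mul_const _) (hI _ _ _) fun v hv => ?_
    refine mul_le_mul_of_nonneg_left ?_ (retProb_nonneg p (hs.trans hv.1) 0)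
    have := surv_le_one p hs y
    have := surv_antitone p ht (by linarith [hv.2] : t ≤ 2 * t - v) y
    linarith
  have h4 : ∫ v in (0 : ℝ)..s, retProb p v 0 * (surv p s y - surv p t y) ≤
      (∫ v in (0 : ℝ)..s, retProb p v 0 * (1 - surv p (2 * t - v) y)) -
        ∫ v in (0 : ℝ)..s, retProb p v 0 * (1 - surv p (s - v) y) := by
    rw [← intervalIntegral.integral_sub (hI _ _ _) (hI _ _ _)]
    refine intervalIntegral.integral_mono_on hs
      ((intervalIntegrable_retProb p 0 _ _).mul_const _) ((hI _ _ _).sub (hI _ _ _)) fun v hv => ?_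
    rw [← mul_sub]
    refine mul_le_mul_of_nonneg_left ?_ (retProb_nonneg p hv.1 0)
    have := surv_antitone p (sub_nonneg.2 hv.2) (by linarith [hv.1] : s - v ≤ s) y
    have := surv_antitone p ht (by linarith [hv.2] : t ≤ 2 * t - v) y
    linarith
  rw [intervalIntegral.integral_mul_const] at h3 h4
  rw [← retGreen_sub] at h3
  have h5 : ∫ v in (0 : ℝ)..s, retProb p v 0 = retGreen p s := rfl
  rw [h5] at h4
  linarith

lemma potUpTo_le_add (hsymm : ∀ x : ℤ, p (-x) = p x) {t : ℝ} (ht : 0 ≤ t) (x : ℤ) :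
    potUpTo p x t ≤ retProb p (t / 2) 0 * (∫ s in (0 : ℝ)..t, surv p s x) +
      retGreen p t * surv p (t / 2) x := by
  have hI := fun a b => (continuous_retProb_mul_surv p t x).intervalIntegrable (μ := volume) a b
  have hS := fun a b => (continuous_surv p x).intervalIntegrable (μ := volume) a b
  have hu := retProb_nonneg p (by linarith : 0 ≤ t / 2) 0
  rw [potUpTo, integral_retProb_sub,
    ← intervalIntegral.integral_add_adjacent_intervals (hI 0 (t / 2)) (hI (t / 2) t)]
  refine add_le_add ?_ ?_
  · have h1 : ∫ s in (0 : ℝ)..(t / 2), retProb p (t - s) 0 * surv p s x ≤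
        ∫ s in (0 : ℝ)..(t / 2), retProb p (t / 2) 0 * surv p s x :=
      intervalIntegral.integral_mono_on (by linarith) (hI _ _) ((hS _ _).const_mul _)
        fun s hs => mul_le_mul_of_nonneg_right (retProb_antitone hsymm (by linarith [hs.2]))
          (surv_nonneg p hs.1 x)
    rw [intervalIntegral.integral_const_mul] at h1
    refine h1.trans (mul_le_mul_of_nonneg_left ?_ hu)
    rw [← intervalIntegral.integral_add_adjacent_intervals (hS 0 (t / 2)) (hS (t / 2) t)]
    have : 0 ≤ ∫ s in (t / 2)..t, surv p s x :=
      intervalIntegral.integral_nonneg (by linarith) fun s hs =>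
        surv_nonneg p (by linarith [hs.1]) x
    linarith
  · have h1 : ∫ s in (t / 2)..t, retProb p (t - s) 0 * surv p s x ≤
        ∫ s in (t / 2)..t, retProb p (t - s) 0 * surv p (t / 2) x := by
      refine intervalIntegral.integral_mono_on (by linarith) (hI _ _)
        (Continuous.intervalIntegrable ?_ _ _) fun s hs => mul_le_mul_of_nonneg_left
          (surv_antitone p (by linarith) hs.1 x) (retProb_nonneg p (sub_nonneg.2 hs.2) 0)
      exact ((continuous_retProb p 0).comp (continuous_const.sub continuous_id)).mul
        continuous_const
    rw [intervalIntegral.integral_mul_const, integral_retProb_sub_left, sub_self, retGreen_zero,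
      sub_zero] at h1
    refine h1.trans (mul_le_mul_of_nonneg_right ?_ (surv_nonneg p (by linarith) x))
    exact retGreen_mono p (by linarith) (by linarith)

lemma IsHeavyTailedKernel.exists_integral_surv_le (hp : IsHeavyTailedKernel α p) (hα0 : 0 < α)
    (hα1 : α ≤ 1) : ∃ C > 0, ∃ t₀ > 0, ∀ t ≥ t₀, ∀ x : ℤ, x ≠ 0 →
      ∫ s in (0 : ℝ)..t, surv p s x ≤ C * (potKernel p x * (t / retGreen p t)) := by
  obtain ⟨t₀, ht₀, h⟩ := hp.integral_inv_retGreen_le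
  obtain ⟨c, hc, hpot⟩ := hp.exists_le_potKernel hα0 hα1
  refine ⟨t₀ / c + 17, by positivity, t₀, ht₀, fun t ht x hx => ?_⟩
  have ht0 : 0 < t := ht₀.trans_le ht
  have hS := fun a b => (continuous_surv p x).intervalIntegrable (μ := volume) a b
  have ha := hpot x hx
  have hG := retGreen_pos hp.symm ht0
  have h1 : ∫ s in (0 : ℝ)..t₀, surv p s x ≤ t₀ := by
    have := intervalIntegral.integral_mono_on ht₀.le (hS 0 t₀)
      (intervalIntegrable_const (c := (1 : ℝ))) fun s hs => surv_le_one p hs.1 x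
    simpa using this
  have h2 : ∫ s in t₀..t, surv p s x ≤ potKernel p x * (17 * (t / retGreen p t)) := by
    refine le_trans ?_ (mul_le_mul_of_nonneg_left (h t ht) (hc.le.trans ha))
    rw [← intervalIntegral.integral_const_mul]
    refine intervalIntegral.integral_mono_on ht (hS _ _) (ContinuousOn.intervalIntegrable ?_)
      fun s hs => ?_
    · rw [uIcc_of_le ht]
      exact continuousOn_const.mul ((continuous_retGreen p).continuousOn.inv₀ fun s hs =>
        (retGreen_pos hp.symm (ht₀.trans_le hs.1)).ne')
    · rw [← div_eq_mul_inv]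
      exact hp.surv_le_div hα0 hα1 (ht₀.trans_le hs.1) x
  rw [← intervalIntegral.integral_add_adjacent_intervals (hS 0 t₀) (hS t₀ t)]
  have h3 : 1 ≤ t / retGreen p t := (one_le_div hG).2 (retGreen_le hp.symm ht0.le)
  -- The contribution of `[0, t₀]` is absorbed using `a(x) ≥ c` and `G(t) ≤ t`.
  have h4 : t₀ ≤ t₀ / c * (potKernel p x * (t / retGreen p t)) := by
    have h5 : c * 1 ≤ potKernel p x * (t / retGreen p t) :=
      mul_le_mul ha h3 zero_le_one (hc.le.trans ha)
    calc t₀ = t₀ / c * (c * 1) := by field_simp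
      _ ≤ _ := mul_le_mul_of_nonneg_left h5 (by positivity)
  linarith

lemma IsHeavyTailedKernel.exists_potUpTo_sub_retGreen_mul_surv_le (hp : IsHeavyTailedKernel α p)
    (hα0 : 0 < α) (hα1 : α ≤ 1) : ∃ C > 0, ∃ t₀ > 0, ∀ t ≥ t₀, ∀ x : ℤ, x ≠ 0 →
      potUpTo p x t - retGreen p t * surv p t x ≤
        C * (potKernel p x * (t * retProb p t 0) / retGreen p t) := by
  obtain ⟨C, hC, t₀, ht₀, hS⟩ := hp.exists_integral_surv_le hα0 hα1
  obtain ⟨D, hD, hdoub⟩ := hp.retProb_doubling hα0 hα1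
  obtain ⟨c, hc, hpot⟩ := hp.exists_le_potKernel hα0 hα1
  refine ⟨D * C + 10 * D ^ 2, by positivity, t₀, ht₀, fun t ht x hx => ?_⟩
  have ht0 : 0 < t := ht₀.trans_le ht
  have hG := retGreen_pos hp.symm ht0
  have ha : 0 < potKernel p x := hc.trans_le (hpot x hx)
  have hu := retProb_nonneg p ht0.le 0
  have hu2 : retProb p (t / 2) 0 ≤ D * retProb p t 0 := by
    have := hdoub (t / 2) (by linarith)
    rwa [mul_div_cancel₀ _ two_ne_zero] at this
  have hu4 : retProb p (t / 4) 0 ≤ D ^ 2 * retProb p t 0 := by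
    have := hdoub (t / 4) (by linarith)
    rw [show 2 * (t / 4) = t / 2 by ring] at this
    nlinarith
  have hG2 : retGreen p t ≤ 2 * retGreen p (t / 2) := by
    have := retGreen_two_mul_le hp.symm (t := t / 2) (by linarith)
    rwa [mul_div_cancel₀ _ two_ne_zero] at this
  have hG4 : retGreen p t ≤ 4 * retGreen p (t / 4) := by
    have := retGreen_two_mul_le hp.symm (t := t / 4) (by linarith)
    rw [show 2 * (t / 4) = t / 2 by ring] at this
    linarith
  have hG34 : retGreen p t ≤ 2 * retGreen p (3 * t / 4) := by
    have := retGreen_mono p (by linarith : 0 ≤ t / 2) (by linarith : t / 2 ≤ 3 * t / 4)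
    linarith
  -- The increment lemma integrates `u` over `[t/4, 3t/2]`, of length `5t/4`; a factor `2` comes
  -- from `G(t) ≤ 2 G(3t/4)` and `D²` from `u(t/4) ≤ D² u(t)`.
  set M : ℝ := 5 / 2 * D ^ 2 * (t * retProb p t 0) / retGreen p t with hM
  have hM0 : 0 ≤ M := by positivity
  have hinc : ∀ y, surv p (t / 4) y - surv p (3 * t / 4) y ≤ M := fun y => by
    have h1 := surv_sub_mul_retGreen_le hp.symm (by linarith : 0 ≤ t / 4)
      (by linarith : t / 4 ≤ 3 * t / 4) y
    have h2 := integral_retProb_le hp.symm (by linarith : t / 4 ≤ 2 * (3 * t / 4))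
    have h3 : 0 ≤ surv p (t / 4) y - surv p (3 * t / 4) y :=
      sub_nonneg.2 (surv_antitone p (by linarith) (by linarith) y)
    have h4 := mul_le_mul_of_nonneg_left hG34 h3
    have h5 : (2 * (3 * t / 4) - t / 4) * retProb p (t / 4) 0 ≤
        5 / 4 * t * (D ^ 2 * retProb p t 0) := by
      rw [show 2 * (3 * t / 4) - t / 4 = 5 / 4 * t by ring]
      exact mul_le_mul_of_nonneg_left hu4 (by linarith)
    rw [hM, le_div_iff₀ hG]
    linarith
  -- Markov property at time `t/4`, with `t/2 = t/4 + t/4` and `t = t/4 + 3t/4`.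
  have hdiff : surv p (t / 2) x - surv p t x ≤ M * (4 * potKernel p x / retGreen p t) := by
    have h1 := surv_add_sub_le p (by linarith : 0 ≤ t / 4) hinc x
    rw [show t / 4 + t / 4 = t / 2 by ring, show t / 4 + 3 * t / 4 = t by ring] at h1
    refine h1.trans (mul_le_mul_of_nonneg_left ?_ hM0)
    refine (hp.surv_le_div hα0 hα1 (by linarith : 0 < t / 4) x).trans ?_
    rw [div_le_div_iff₀ (retGreen_pos hp.symm (by linarith)) hG]
    nlinarith
  have h1 := potUpTo_le_add hp.symm ht0.le x
  have h2 : retProb p (t / 2) 0 * (∫ s in (0 : ℝ)..t, surv p s x) ≤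
      D * retProb p t 0 * (C * (potKernel p x * (t / retGreen p t))) := by
    refine mul_le_mul hu2 (hS t ht x hx) ?_ (by positivity)
    exact intervalIntegral.integral_nonneg ht0.le fun s hs => surv_nonneg p hs.1 x
  have h3 := mul_le_mul_of_nonneg_left hdiff hG.le
  have h4 : retGreen p t * (M * (4 * potKernel p x / retGreen p t)) =
      10 * D ^ 2 * (potKernel p x * (t * retProb p t 0) / retGreen p t) := by
    rw [hM]; field_simp; ring
  have h5 : D * retProb p t 0 * (C * (potKernel p x * (t / retGreen p t))) =
      D * C * (potKernel p x * (t * retProb p t 0) / retGreen p t) := by ring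
  rw [h4] at h3
  rw [h5] at h2
  linarith

lemma IsHeavyTailedKernel.abs_surv_sub_le (hp : IsHeavyTailedKernel α p)
    (hα0 : 0 < α) (hα1 : α ≤ 1) : ∃ C > 0, ∃ t₀ > 0, ∀ t ≥ t₀, ∀ x : ℤ, x ≠ 0 →
      |surv p t x - potKernel p x / retGreen p t| ≤
        C * (potKernel p x * (t * retProb p t 0) / retGreen p t ^ 2) +
          (potKernel p x - potUpTo p x t) / retGreen p t := by
  obtain ⟨C, hC, t₀, ht₀, h⟩ := hp.exists_potUpTo_sub_retGreen_mul_surv_le hα0 hα1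
  refine ⟨C, hC, t₀, ht₀, fun t ht x hx => ?_⟩
  have ht0 : 0 < t := ht₀.trans_le ht
  have hG := retGreen_pos hp.symm ht0
  rw [abs_sub_comm, abs_of_nonneg (sub_nonneg.2 (hp.surv_le_div hα0 hα1 ht0 x))]
  have h1 := div_le_div_of_nonneg_right (h t ht x hx) hG.le
  have h2 : C * (potKernel p x * (t * retProb p t 0) / retGreen p t) / retGreen p t =
      C * (potKernel p x * (t * retProb p t 0) / retGreen p t ^ 2) := by field_simp
  have h3 : (potUpTo p x t - retGreen p t * surv p t x) / retGreen p t =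
      potUpTo p x t / retGreen p t - surv p t x := by field_simp
  rw [h2, h3] at h1
  rw [sub_div]
  linarith

/-! ### The scaling functions -/

lemma stableScale_pos (hα0 : 0 < α) (hα1 : α ≤ 1) : 0 < stableScale α := by
  unfold stableScale
  split_ifs with h
  · positivity
  · have hlt : α < 1 := lt_of_le_of_ne hα1 h
    have hπ := Real.pi_pos
    exact mul_pos (Real.cos_pos_of_mem_Ioo ⟨by nlinarith, by nlinarith⟩)
      (Real.Gamma_pos_of_pos (by linarith))

lemma stableDensity_zero_pos (hα0 : 0 < α) (hα1 : α ≤ 1) : 0 < stableDensity α 0 := by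
  have hγ := stableScale_pos hα0 hα1
  unfold stableDensity
  simp only [mul_zero, Real.cos_zero, one_mul]
  rw [integral_comp_abs (f := fun u => Real.exp (-stableScale α * u ^ α)),
    integral_exp_neg_mul_rpow hα0 hγ]
  have := Real.Gamma_pos_of_pos (by positivity : 0 < 1 / α + 1)
  positivity

lemma smallL_eq (p : PMF ℤ) {t : ℝ} (ht : 0 ≤ t) :
    smallL α p t = retGreen p t / stableDensity α 0 := by
  rw [smallL, green_eq p ht]

/-- The stable density at `0` enters `B` and `l` reciprocally and cancels, so only its being nonzero
matters. -/
lemma ellFun_eq (p : PMF ℤ) (hg : stableDensity α 0 ≠ 0) {t : ℝ} (ht : 0 ≤ t) :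
    ellFun α p t = retGreen p t / (t * retProb p t 0) := by
  rw [ellFun, smallL_eq p ht, scaleB, transProb_eq_semigroup p 0 ht, ← retProb]
  field_simp

end

end HeavyTailedWalk

/-! ### Assembly of the two estimates -/

open HeavyTailedWalk

theorem proposition2p8 (α : ℝ) (hα0 : 0 < α) (hα1 : α ≤ 1) (p : PMF ℤ)
    (hp : HeavyTailedWalk.IsHeavyTailedKernel α p) :
    -- the limit defining the potential kernel exists
    (∀ x : ℤ, Tendsto (HeavyTailedWalk.potKernelUpTo p x) atTop
      (𝓝 (HeavyTailedWalk.potKernel p x))) ∧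
    -- the case `α = 1`
    (α = 1 → ∃ κ : ℝ, 0 < κ ∧ ∃ C : ℝ, ∀ᶠ t : ℝ in atTop, ∀ x : ℤ, x ≠ 0 →
      |HeavyTailedWalk.hitTail p x t - HeavyTailedWalk.potKernel p x /
          (HeavyTailedWalk.stableDensity α 0 * HeavyTailedWalk.smallL α p t)| ≤
        C * (HeavyTailedWalk.potKernel p x /
            (HeavyTailedWalk.smallL α p t * HeavyTailedWalk.ellFun α p t) +
          |(x : ℝ)| / t ^ κ)) ∧
    -- the case `α < 1`
    (α < 1 → ∀ ε : ℝ, 0 < ε → ∃ C : ℝ, ∀ᶠ t : ℝ in atTop, ∀ x : ℤ, x ≠ 0 →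
      |HeavyTailedWalk.hitTail p x t - HeavyTailedWalk.potKernel p x /
          (HeavyTailedWalk.stableDensity α 0 * HeavyTailedWalk.smallL α p t)| ≤
        C * (HeavyTailedWalk.potKernel p x /
            (HeavyTailedWalk.smallL α p t * HeavyTailedWalk.ellFun α p t) +
          t ^ ε / HeavyTailedWalk.ellFun α p t)) := by
  have hg := stableDensity_zero_pos hα0 hα1
  obtain ⟨C₁, hC₁, t₁, ht₁, hmain⟩ := hp.abs_surv_sub_le hα0 hα1
  obtain ⟨c, hc, hpot⟩ := hp.exists_le_potKernel hα0 hα1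
  have hlead : ∀ t > 0, stableDensity α 0 * smallL α p t = retGreen p t := fun t ht => by
    rw [smallL_eq p ht.le, mul_div_cancel₀ _ hg.ne']
  have herr : ∀ t > 0, ∀ x, potKernel p x / (smallL α p t * ellFun α p t) =
      stableDensity α 0 * (potKernel p x * (t * retProb p t 0) / retGreen p t ^ 2) :=
    fun t ht x => by
      have h1 := retGreen_pos hp.symm ht
      have h2 := retProb_pos hp.symm ht.le
      rw [smallL_eq p ht.le, ellFun_eq p hg.ne' ht.le]
      field_simp
  -- Both cases differ only in how the truncation error is bounded by a multiple `K` of the second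
  -- error term `E`.
  have hcombine : ∀ t ≥ t₁, ∀ x : ℤ, x ≠ 0 → ∀ K E : ℝ, 0 ≤ K → 0 ≤ E →
      (potKernel p x - potUpTo p x t) / retGreen p t ≤ K * E →
      |hitTail p x t - potKernel p x / (stableDensity α 0 * smallL α p t)| ≤
        max (C₁ / stableDensity α 0) K *
          (potKernel p x / (smallL α p t * ellFun α p t) + E) := fun t ht x hx K E hK hE h => by
    have ht0 : 0 < t := ht₁.trans_le ht
    have h1 := hmain t ht x hx
    have ha : 0 < potKernel p x := hc.trans_le (hpot x hx)
    have hu := retProb_nonneg p ht0.le 0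
    rw [surv_eq_hitTail p hx ht0.le] at h1
    rw [hlead t ht0, herr t ht0, mul_add]
    refine h1.trans (add_le_add ?_ (h.trans (mul_le_mul_of_nonneg_right (le_max_right _ _) hE)))
    refine le_trans (le_of_eq ?_) (mul_le_mul_of_nonneg_right (le_max_left _ _) (by positivity))
    field_simp
  refine ⟨fun x => ?_, fun _ => ?_, fun hα ε hε => ?_⟩
  · exact (hp.tendsto_potUpTo hα0 hα1 x).congr'
      ((eventually_ge_atTop 0).mono fun t ht => (potKernelUpTo_eq p x ht).symm)
  · obtain ⟨C₂, hC₂, h⟩ := hp.exists_potUpTo_sub_le hα0 hα1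
    have hG1 := retGreen_pos hp.symm one_pos
    -- The exponent is that of the truncation bound; dividing by `G(t) ≥ G(1)` costs only a
    -- constant.
    refine ⟨1 / 2, by norm_num, max (C₁ / stableDensity α 0) (C₂ / retGreen p 1), ?_⟩
    filter_upwards [eventually_ge_atTop t₁, eventually_ge_atTop 1] with t ht ht1 x hx
    have ht0 : 0 < t := ht₁.trans_le ht
    refine hcombine t ht x hx _ _ (by positivity) (by positivity) ?_
    have h1 := hp.potKernel_sub_le hα0 hα1 (h x t ht0)
    have h2 := retGreen_mono p zero_le_one ht1
    calc (potKernel p x - potUpTo p x t) / retGreen p t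
        ≤ C₂ * (|(x : ℝ)| / t ^ (1 / 2 : ℝ)) / retGreen p 1 := by gcongr
      _ = _ := by ring
  · obtain ⟨C₂, hC₂, t₂, ht₂, h⟩ := hp.exists_integral_retProb_le hα0 hα
    refine ⟨max (C₁ / stableDensity α 0) C₂, ?_⟩
    filter_upwards [eventually_ge_atTop t₁, eventually_ge_atTop t₂, eventually_ge_atTop 1] with
      t ht ht2 ht1 x hx
    have ht0 : 0 < t := ht₁.trans_le ht
    have hG := retGreen_pos hp.symm ht0
    have hu := retProb_nonneg p ht0.le 0
    have hE : t ^ ε / ellFun α p t = t ^ ε * (t * retProb p t 0 / retGreen p t) := by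
      rw [ellFun_eq p hg.ne' ht0.le, div_div_eq_mul_div, mul_div_assoc]
    rw [hE]
    refine hcombine t ht x hx _ _ hC₂.le (by positivity) ?_
    -- Dropping the probability of being at `0` from `x` bounds the truncation by the tail integral
    -- of `u`, uniformly in `x`. This already gives `1/ℓ(t)`, and `t ^ ε ≥ 1` for `t ≥ 1`.
    have h1 := hp.potKernel_sub_le hα0 hα1 (x := x) (t := t) fun T hT => by
      rw [potUpTo_sub]
      refine le_trans ?_ (h t ht2 T hT)
      exact intervalIntegral.integral_mono_on hT
        ((continuous_retProb_sub p x).intervalIntegrable _ _)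
        (intervalIntegrable_retProb p 0 _ _) fun s hs =>
          sub_le_self _ (retProb_nonneg p (ht0.le.trans hs.1) x)
    have h2 : 1 ≤ t ^ ε := Real.one_le_rpow ht1 hε.le
    have h3 : 0 ≤ t * retProb p t 0 / retGreen p t := by positivity
    calc (potKernel p x - potUpTo p x t) / retGreen p t
        ≤ C₂ * (t * retProb p t 0) / retGreen p t := by gcongr
      _ = C₂ * (1 * (t * retProb p t 0 / retGreen p t)) := by ring
      _ ≤ _ := by gcongr
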